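/- Let $n,b\ge 2$ be integers and let $\tau\ge n-1$ be real. Let $\mathbb T^n=\mathbb R^n/2\pi\mathbb Z^n$. For $f\in L^2(\mathbb T^n;\mathbb R^n)$ let $f_k=(2\pi)^{-n}\int_{\mathbb T^n}f(x)e^{-\mathrm i\langle k,x\rangle}\,dx\in\mathbb C^n$ $(k\in\mathbb Z^n)$ be its Fourier coefficients, put $|k|=\sum_{j=1}^n|k_j|$, and let $\widetilde{\mathcal L^2_{\tau+1,b}}(\mathbb T^n)$ be the space of all $f\in L^2(\mathbb T^n;\mathbb R^n)$ (identified when equal almost everywhere) with $$\sum_{\nu=0}^\infty\Big(\sum_{b^{\nu-1}<|k|\le b^\nu}|f_k|^2|k|^{2\tau+2}\Big)^{1/2}<+\infty .$$ For a multi-index $\alpha\in\mathbb N^n$ put $|\alpha|=\sum_{j=1}^n\alpha_j$. A weak derivative $\partial^\alpha f$ is a map $g\in L^2(\mathbb T^n;\mathbb R^n)$ with $\int_{\mathbb T^n} f\,\partial^\alpha\varphi\,dx=(-1)^{|\alpha|}\int_{\mathbb T^n} g\,\varphi\,dx$ for all $\varphi\in C^\infty(\mathbb T^n;\mathbb R)$.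 Write $[x]$ for the integer part of $x$. Then: 1. Every $f\in\widetilde{\mathcal L^2_{\tau+1,b}}(\mathbb T^n)$ agrees almost everywhere with a map of class $C^{[\tau-n/2]+1}$ on $\mathbb T^n$. 2. Every $f\in\widetilde{\mathcal L^2_{\tau+1,b}}(\mathbb T^n)$ has weak derivatives $\partial^\alpha f$ for all $\alpha$ with $|\alpha|\le[\tau]+1$. 3. There is an $f\in\widetilde{\mathcal L^2_{\tau+1,b}}(\mathbb T^n)$ such that for every $\alpha$ with $[\tau-n/2]+2\le|\alpha|\le[\tau]+1$ the weak derivative $\partial^\alpha f$ exists and is essentially unbounded, and such that $f$ does not agree almost everywhere with any map of class $C^{[\tau-n/2]+2}$ on $\mathbb T^n$. 4. There is an $f\in\widetilde{\mathcal L^2_{\tau+1,b}}(\mathbb T^n)$ such that for no $\alpha$ with $|\alpha|=[\tau]+2$ the weak derivative $\partial^\alpha f$ exists. In particular the highest order $[\tau-n/2]+1$ of classical differentiability and the highest order $[\tau]+1$ of weak differentiability are both sharp. -/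

import Mathlib

open MeasureTheory
open scoped ENNReal ContDiff

instance fact_two_pi_pos : Fact ((0 : ℝ) < 2 * Real.pi) := ⟨Real.two_pi_pos⟩

/-- The standard torus `𝕋ⁿ = ℝⁿ / 2πℤⁿ`. Its `volume` is the product of the Lebesgue measures of the
circles `ℝ / 2πℤ`, so that the total mass is `(2π)ⁿ`. -/
abbrev Torus (n : ℕ) : Type := Fin n → AddCircle (2 * Real.pi)

namespace Torus

/-- The canonical projection `ℝⁿ → 𝕋ⁿ`. -/
noncomputable def proj (n : ℕ) (x : Fin n → ℝ) : Torus n := fun j => (x j : AddCircle (2 * Real.pi))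

/-- `g : 𝕋ⁿ → E` is of class `C^m`: its `2π`-periodic lift to `ℝⁿ` is of class `C^m`. -/
def IsClassC {n : ℕ} {E : Type*} [NormedAddCommGroup E] [NormedSpace ℝ E]
    (m : ℕ∞) (g : Torus n → E) : Prop :=
  ContDiff ℝ m (fun x : Fin n → ℝ => g (proj n x))

/-- The exponential `x ↦ e^{i⟨k,x⟩}` on `𝕋ⁿ`. -/
noncomputable def char {n : ℕ} (k : Fin n → ℤ) (x : Torus n) : ℂ :=
  ∏ j, fourier (k j) (x j)

theorem char_proj {n : ℕ} (k : Fin n → ℤ) (x : Fin n → ℝ) :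
    char k (proj n x) = Complex.exp (Complex.I * ∑ j, (k j : ℂ) * (x j : ℂ)) := by
  unfold char proj
  rw [Finset.mul_sum, Complex.exp_sum]
  refine Finset.prod_congr rfl fun j _ => ?_
  rw [fourier_coe_apply]
  congr 1
  have h : (Real.pi : ℂ) ≠ 0 := by exact_mod_cast Real.pi_ne_zero
  push_cast
  field_simp

/-- The `k`-th Fourier coefficient `f_k = (2π)⁻ⁿ ∫ f(x) e^{-i⟨k,x⟩} dx ∈ ℂⁿ` of `f : 𝕋ⁿ → ℝⁿ`. -/
noncomputable def fourierCoeff {n : ℕ} (f : Torus n → EuclideanSpace ℝ (Fin n))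
    (k : Fin n → ℤ) : EuclideanSpace ℂ (Fin n) :=
  WithLp.toLp 2 fun i =>
    (((2 * Real.pi) ^ n)⁻¹ : ℂ) * ∫ x : Torus n, ((f x i : ℝ) : ℂ) * char (-k) x

/-- `|k| = ∑ |k_j|`. -/
def freq {n : ℕ} (k : Fin n → ℤ) : ℝ := ∑ j, |(k j : ℝ)|

/-- The shell of frequencies with `b^(ν-1) < |k| ≤ b^ν`. -/
def shell (n b ν : ℕ) : Set (Fin n → ℤ) :=
  {k | (b : ℝ) ^ ((ν : ℤ) - 1) < freq k ∧ freq k ≤ (b : ℝ) ^ ν}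

/-- The weighted norm `∑_ν (∑_{b^(ν-1) < |k| ≤ b^ν} |f_k|² |k|^{2τ+2})^{1/2}`, with values in
`[0, ∞]`. -/
noncomputable def poschelNorm {n : ℕ} (τ : ℝ) (b : ℕ)
    (f : Torus n → EuclideanSpace ℝ (Fin n)) : ℝ≥0∞ :=
  ∑' ν : ℕ, (∑' k : shell n b ν,
    ENNReal.ofReal (‖fourierCoeff f k‖ ^ 2 * freq (k : Fin n → ℤ) ^ (2 * τ + 2))) ^ (1 / 2 : ℝ)

/-- Pöschel's weighted Sobolev space of mappings `f : 𝕋ⁿ → ℝⁿ`. (As usual for spaces defined by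
Fourier expansions, its members are square integrable maps, regarded up to a.e. equality; square
integrability is forced by finiteness of the norm.) -/
def poschelSpace (n : ℕ) (τ : ℝ) (b : ℕ) : Set (Torus n → EuclideanSpace ℝ (Fin n)) :=
  {f | MemLp f 2 volume ∧ poschelNorm τ b f < ⊤}

/-- The classical partial derivative `∂_j φ` of a function on `𝕋ⁿ`. -/
noncomputable def partialDeriv {n : ℕ} (j : Fin n) (φ : Torus n → ℝ) : Torus n → ℝ :=
  fun x => deriv (fun t : ℝ => φ (x + Pi.single j (t : AddCircle (2 * Real.pi)))) 0

theorem partialDeriv_proj {n : ℕ} (j : Fin n) (φ : Torus n → ℝ) (x : Fin n → ℝ) :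
    partialDeriv j φ (proj n x) =
      lineDeriv ℝ (fun y : Fin n → ℝ => φ (proj n y)) x (Pi.single j 1) := by
  unfold partialDeriv lineDeriv
  congr 1
  funext t
  congr 1
  funext i
  by_cases h : i = j
  · subst h; simp [proj]
  · simp [proj, h]

/-- The iterated classical partial derivative `∂^α φ = ∂₁^{α₁} ⋯ ∂ₙ^{αₙ} φ`. -/
noncomputable def multiDeriv {n : ℕ} (α : Fin n → ℕ) (φ : Torus n → ℝ) : Torus n → ℝ :=
  (List.finRange n).foldr (fun j ψ => (partialDeriv j)^[α j] ψ) φ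

/-- `g` is the weak derivative `∂^α f` (in the `L²` sense): `g ∈ L²(𝕋ⁿ)` and
`∫ f ∂^α φ = (-1)^|α| ∫ g φ` for every smooth function `φ` on `𝕋ⁿ`. -/
def IsWeakDeriv {n : ℕ} (α : Fin n → ℕ) (f g : Torus n → EuclideanSpace ℝ (Fin n)) : Prop :=
  MemLp g 2 volume ∧
    ∀ φ : Torus n → ℝ, IsClassC (⊤ : ℕ∞) φ →
      ∫ x, multiDeriv α φ x • f x = (-1 : ℝ) ^ (∑ j, α j) • ∫ x, φ x • g x

/-- `g` is essentially unbounded. -/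
def EssUnbounded {n : ℕ} (g : Torus n → EuclideanSpace ℝ (Fin n)) : Prop :=
  ∀ C : ℝ, ¬ ∀ᵐ x, ‖g x‖ ≤ C

end Torus

namespace Torus

open scoped ComplexConjugate

variable {n : ℕ}

/-! ### The exponentials -/

/-! Everything is read off Fourier coefficients, where `∂^α` multiplies by `∏ (i k_j)^{α_j}`, of
modulus at most `|k|^{|α|}`.

Regularity. The norm is an `ℓ¹` sum over shells of weighted `ℓ²` norms, so it dominates the full
`ℓ²` sum with weight `|k|^{2τ+2}`; by Riesz–Fischer and Parseval, weak derivatives exist for `|α| ≤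
τ + 1` (`exists_isWeakDeriv`). On one shell, Cauchy–Schwarz bounds `∑ |k|^m |f_k|` by the shell norm
times `(∑ |k|^{-n})^{1/2}`, and the latter is bounded uniformly in the shell. Summing over shells
gives absolute convergence for all `m ≤ τ + 1 - n/2`, endpoint included (`summable_rpow_mul`); the
Fourier series can then be differentiated termwise `m` times.

Sharpness. A single map serves both counterexamples: two of its components are the real and
imaginary parts of a function `F` with coefficients `|k|^{-σ}` on the open positive orthant, where
`σ = τ + 1 + n/2 + ε`. There the coefficients of `∂^α F` all share the phase `i^{|α|}`, so up to a
constant rotation they are nonnegative. A bounded function with nonnegative coefficients has bounded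
coefficient sums over the cubes `(N, 2N]^n` (`sum_cube_le`), by a Fejér-type kernel, whereas these
sums grow like `N^{n + |α| - σ}`. Likewise the sums of squares grow like `N^{n + 2|α| - 2σ}`, which
contradicts square integrability. For `ε` small the two exponents become positive at `|α| = [τ -
n/2] + 2` and `|α| = [τ] + 2`. -/

theorem continuous_char (k : Fin n → ℤ) : Continuous (char k) := by
  unfold char
  fun_prop

theorem char_neg (k : Fin n → ℤ) (x : Torus n) : char (-k) x = conj (char k x) := by
  simp only [char, Pi.neg_apply, fourier_neg, map_prod]

theorem char_add (k l : Fin n → ℤ) (x : Torus n) : char (k + l) x = char k x * char l x := by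
  simp only [char, Pi.add_apply, fourier_add, ← Finset.prod_mul_distrib]

theorem char_zero (x : Torus n) : char (0 : Fin n → ℤ) x = 1 := by
  simp [char]

theorem norm_char (k : Fin n → ℤ) (x : Torus n) : ‖char k x‖ = 1 := by
  rw [char, norm_prod]
  exact Finset.prod_eq_one fun j _ => by rw [fourier_apply]; exact Circle.norm_coe _

theorem char_add_right (k : Fin n → ℤ) (x y : Torus n) : char k (x + y) = char k x * char k y := by
  simp only [char, Pi.add_apply, fourier_apply, smul_add, AddCircle.toCircle_add, Circle.coe_mul,
    Finset.prod_mul_distrib]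

theorem char_single_coe (k : Fin n → ℤ) (j : Fin n) (t : ℝ) :
    char k (Pi.single j (t : AddCircle (2 * Real.pi))) = Complex.exp (Complex.I * k j * t) := by
  have h : Pi.single j (t : AddCircle (2 * Real.pi)) = proj n (Pi.single j t) := by
    funext i
    by_cases h : i = j
    · subst h; simp [proj]
    · simp [proj, h]
  rw [h, char_proj, Finset.sum_eq_single j]
  · simp [mul_assoc]
  · intro i _ hi
    simp [hi]
  · simp

/-- The exponential with frequency `k` as a continuous map. -/
noncomputable def charMap (k : Fin n → ℤ) : C(Torus n, ℂ) := ⟨char k, continuous_char k⟩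

theorem separatesPoints_adjoin_charMap :
    (Algebra.adjoin ℂ (Set.range (charMap (n := n)))).SeparatesPoints := by
  intro x y hxy
  obtain ⟨i, hi⟩ := Function.ne_iff.mp hxy
  refine ⟨_, ⟨charMap (Pi.single i 1), Algebra.subset_adjoin ⟨Pi.single i 1, rfl⟩, rfl⟩, ?_⟩
  have h : ∀ z : Torus n, charMap (Pi.single i 1) z = fourier 1 (z i) := by
    intro z
    change ∏ j : Fin n, fourier ((Pi.single i 1 : Fin n → ℤ) j) (z j) = _
    rw [Finset.prod_eq_single i]
    · simp
    · intro j _ hj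
      simp [hj]
    · simp
  dsimp only
  rw [h, h, fourier_one, fourier_one]
  contrapose! hi
  exact AddCircle.injective_toCircle Real.two_pi_pos.ne' (Circle.ext hi)

/-- Stone–Weierstrass: products and conjugates of exponentials are exponentials, so their linear
span is already a star subalgebra. -/
theorem span_charMap_closure_eq_top :
    (Submodule.span ℂ (Set.range (charMap (n := n)))).topologicalClosure = ⊤ := by
  let A : StarSubalgebra ℂ C(Torus n, ℂ) :=
    { toSubalgebra := Algebra.adjoin ℂ (Set.range charMap)
      star_mem' := by
        change Algebra.adjoin ℂ (Set.range charMap) ≤ star (Algebra.adjoin ℂ (Set.range charMap))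
        refine Algebra.adjoin_le ?_
        rintro _ ⟨k, rfl⟩
        refine Algebra.subset_adjoin ⟨-k, ?_⟩
        ext1 x
        simp [charMap, char_neg] }
  have hA : A.toSubalgebra.toSubmodule = Submodule.span ℂ (Set.range charMap) := by
    apply Algebra.adjoin_eq_span_of_subset
    refine .trans (fun x ↦ Submonoid.closure_induction (fun _ ↦ id) ⟨0, ?_⟩ ?_)
      Submodule.subset_span
    · ext z
      simp [charMap, char_zero]
    · rintro _ _ _ _ ⟨k, rfl⟩ ⟨l, rfl⟩
      refine ⟨k + l, ?_⟩
      ext z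
      simp [charMap, char_add]
  have htop : A.topologicalClosure = ⊤ :=
    ContinuousMap.starSubalgebra_topologicalClosure_eq_top_of_separatesPoints _
      separatesPoints_adjoin_charMap
  rw [← hA]
  exact congr_arg (Subalgebra.toSubmodule <| StarSubalgebra.toSubalgebra ·) htop

/-! ### Fourier coefficients of scalar functions -/

theorem integral_char_eq_zero {k : Fin n → ℤ} (hk : k ≠ 0) : ∫ x : Torus n, char k x = 0 := by
  obtain ⟨j, hj⟩ := Function.ne_iff.mp hk
  have hj' : (k j : ℂ) ≠ 0 := by exact_mod_cast hj
  -- Translation by `π / k_j` in the `j`-th coordinate multiplies the exponential by `e^{iπ} = -1`.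
  refine integral_eq_zero_of_add_right_eq_neg
    (g := Pi.single j ((Real.pi / k j : ℝ) : AddCircle (2 * Real.pi))) fun x => ?_
  rw [char_add_right, char_single_coe]
  have : Complex.I * k j * ((Real.pi / k j : ℝ) : ℂ) = Real.pi * Complex.I := by
    push_cast
    field_simp
  rw [this, Complex.exp_pi_mul_I]
  ring

theorem volume_real_univ : (volume : Measure (Torus n)).real Set.univ = (2 * Real.pi) ^ n := by
  rw [Measure.real, MeasureTheory.volume_pi, Measure.pi_univ]
  simp [AddCircle.measure_univ, Real.pi_nonneg]

/-- The Fourier coefficients of a scalar function on the torus. -/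
noncomputable def scalarCoeff (u : Torus n → ℂ) (k : Fin n → ℤ) : ℂ :=
  (((2 * Real.pi) ^ n)⁻¹ : ℂ) * ∫ x : Torus n, u x * char (-k) x

/-- The exponentials, normalized in `L²`. -/
noncomputable def charLp (k : Fin n → ℤ) : Lp ℂ 2 (volume : Measure (Torus n)) :=
  ((Real.sqrt ((2 * Real.pi) ^ n))⁻¹ : ℂ) •
    ContinuousMap.toLp (E := ℂ) 2 volume ℂ (charMap k)

theorem sqrt_vol_mul_self (n : ℕ) :
    ((Real.sqrt ((2 * Real.pi) ^ n) : ℝ) : ℂ) * (Real.sqrt ((2 * Real.pi) ^ n) : ℝ) =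
      (2 * Real.pi) ^ n := by
  rw [← Complex.ofReal_mul, Real.mul_self_sqrt (by positivity)]
  push_cast
  rfl

theorem sqrt_vol_ne_zero (n : ℕ) : ((Real.sqrt ((2 * Real.pi) ^ n) : ℝ) : ℂ) ≠ 0 := by
  have : (0 : ℝ) < Real.sqrt ((2 * Real.pi) ^ n) := by positivity
  exact_mod_cast this.ne'

theorem two_pi_pow_ne_zero (n : ℕ) : ((2 * Real.pi : ℂ)) ^ n ≠ 0 := by
  have : (2 * Real.pi) ^ n ≠ 0 := by positivity
  exact_mod_cast this

theorem orthonormal_charLp : Orthonormal ℂ (charLp (n := n)) := by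
  rw [orthonormal_iff_ite]
  intro k l
  rw [charLp, charLp, inner_smul_left, inner_smul_right, ContinuousMap.inner_toLp]
  have h1 : ∀ x : Torus n, charMap l x * conj (charMap k x) = char (l - k) x := by
    intro x
    change char l x * conj (char k x) = _
    rw [← char_neg, ← char_add, sub_eq_add_neg]
  simp only [h1, map_inv₀, Complex.conj_ofReal]
  split_ifs with h
  · subst h
    simp only [sub_self, char_zero, integral_const, volume_real_univ]
    rw [← mul_assoc, ← mul_inv, sqrt_vol_mul_self]
    simp
  · rw [integral_char_eq_zero (sub_ne_zero.mpr (Ne.symm h))]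
    simp

theorem span_charLp_closure_eq_top :
    (Submodule.span ℂ (Set.range (charLp (n := n)))).topologicalClosure = ⊤ := by
  have h := (ContinuousMap.toLp_denseRange ℂ (volume : Measure (Torus n)) ℂ
    (p := 2) (by simp)).topologicalClosure_map_submodule span_charMap_closure_eq_top
  rw [eq_top_iff, ← h]
  refine Submodule.topologicalClosure_mono ?_
  rw [Submodule.map_span, Submodule.span_le]
  rintro _ ⟨_, ⟨k, rfl⟩, rfl⟩
  have : ContinuousMap.toLp (E := ℂ) 2 (volume : Measure (Torus n)) ℂ (charMap k) =
      ((Real.sqrt ((2 * Real.pi) ^ n) : ℝ) : ℂ) • charLp k := by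
    rw [charLp, smul_smul, mul_inv_cancel₀ (sqrt_vol_ne_zero n), one_smul]
  change ContinuousMap.toLp (E := ℂ) 2 (volume : Measure (Torus n)) ℂ (charMap k) ∈ _
  rw [this]
  exact Submodule.smul_mem _ _ (Submodule.subset_span ⟨k, rfl⟩)

/-- The normalized exponentials form a Hilbert basis of `L²(𝕋ⁿ)`. -/
noncomputable def charBasis (n : ℕ) :
    HilbertBasis (Fin n → ℤ) ℂ (Lp ℂ 2 (volume : Measure (Torus n))) :=
  HilbertBasis.mk orthonormal_charLp span_charLp_closure_eq_top.ge

theorem coeFn_charLp (k : Fin n → ℤ) :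
    charLp k =ᵐ[volume] fun x => ((Real.sqrt ((2 * Real.pi) ^ n))⁻¹ : ℂ) * char k x := by
  refine (Lp.coeFn_smul _ _).trans ?_
  filter_upwards [ContinuousMap.coeFn_toLp (p := 2) (𝕜 := ℂ) volume (charMap k)] with x hx
  simp only [Pi.smul_apply, hx, smul_eq_mul]
  rfl

theorem inner_charBasis {u : Torus n → ℂ} (hu : MemLp u 2) (k : Fin n → ℤ) :
    inner ℂ (charBasis n k) (hu.toLp u) =
      ((Real.sqrt ((2 * Real.pi) ^ n) : ℝ) : ℂ) * scalarCoeff u k := by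
  rw [charBasis, HilbertBasis.coe_mk, L2.inner_def]
  have : ∫ x, inner ℂ (charLp k x) (hu.toLp u x) =
      ((Real.sqrt ((2 * Real.pi) ^ n))⁻¹ : ℂ) * ∫ x, u x * char (-k) x := by
    rw [← integral_const_mul]
    refine integral_congr_ae ?_
    filter_upwards [coeFn_charLp k, hu.coeFn_toLp] with x hx hx'
    rw [hx, hx', char_neg]
    simp
    ring
  rw [this, scalarCoeff, ← sqrt_vol_mul_self]
  have := sqrt_vol_ne_zero n
  field_simp

/-- Parseval's identity. -/
theorem hasSum_conj_scalarCoeff_mul {u v : Torus n → ℂ} (hu : MemLp u 2) (hv : MemLp v 2) :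
    HasSum (fun k => conj (scalarCoeff u k) * scalarCoeff v k)
      ((((2 * Real.pi) ^ n)⁻¹ : ℂ) * ∫ x, conj (u x) * v x) := by
  have h := (charBasis n).hasSum_inner_mul_inner (hu.toLp u) (hv.toLp v)
  have h2 : inner ℂ (hu.toLp u) (hv.toLp v) = ∫ x, conj (u x) * v x := by
    rw [L2.inner_def]
    refine integral_congr_ae ?_
    filter_upwards [hu.coeFn_toLp, hv.coeFn_toLp] with x hx hx'
    rw [hx, hx']
    simp [mul_comm]
  rw [h2] at h
  convert! h.mul_left (((2 * Real.pi) ^ n)⁻¹ : ℂ) using 2 with k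
  rw [← inner_conj_symm, inner_charBasis, inner_charBasis, ← sqrt_vol_mul_self]
  have := sqrt_vol_ne_zero n
  simp
  field_simp

/-- The Riesz-Fischer theorem. -/
theorem exists_scalarCoeff_eq {c : (Fin n → ℤ) → ℂ} (hc : Summable fun k => ‖c k‖ ^ 2) :
    ∃ u : Torus n → ℂ, MemLp u 2 ∧ ∀ k, scalarCoeff u k = c k := by
  let d : (Fin n → ℤ) → ℂ := fun k => ((Real.sqrt ((2 * Real.pi) ^ n) : ℝ) : ℂ) * c k
  have hd : Memℓp d 2 := by
    refine memℓp_gen ?_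
    simp only [d, norm_mul, ENNReal.toReal_ofNat, Real.rpow_two, mul_pow]
    exact hc.mul_left _
  let v := (charBasis n).repr.symm ⟨d, hd⟩
  refine ⟨v, Lp.memLp v, fun k => ?_⟩
  have h := inner_charBasis (Lp.memLp v) k
  rw [Lp.toLp_coeFn, ← HilbertBasis.repr_apply_apply, LinearIsometryEquiv.apply_symm_apply] at h
  exact (mul_left_cancel₀ (sqrt_vol_ne_zero n) h).symm

theorem ae_eq_of_scalarCoeff_eq {u v : Torus n → ℂ} (hu : MemLp u 2) (hv : MemLp v 2)
    (h : ∀ k, scalarCoeff u k = scalarCoeff v k) : u =ᵐ[volume] v := by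
  have : hu.toLp u = hv.toLp v := by
    apply (charBasis n).repr.injective
    ext k
    rw [HilbertBasis.repr_apply_apply, HilbertBasis.repr_apply_apply, inner_charBasis,
      inner_charBasis, h]
  exact (MemLp.toLp_eq_toLp_iff hu hv).mp this

theorem summable_norm_scalarCoeff_sq {u : Torus n → ℂ} (hu : MemLp u 2) :
    Summable fun k => ‖scalarCoeff u k‖ ^ 2 := by
  have := (hasSum_conj_scalarCoeff_mul hu hu).summable.norm
  refine this.congr fun k => ?_
  rw [norm_mul, RCLike.norm_conj, sq]

/-! ### Derivatives on the torus -/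

/-- Regularity is defined on lifts to `ℝⁿ`; this is what brings continuity back down to the torus.
-/
theorem isOpenQuotientMap_proj (n : ℕ) : IsOpenQuotientMap (proj n) :=
  IsOpenQuotientMap.piMap fun _ => QuotientAddGroup.isOpenQuotientMap_mk

theorem proj_add_smul_single (x : Fin n → ℝ) (j : Fin n) (t : ℝ) :
    proj n (x + t • Pi.single j 1) = proj n x + Pi.single j (t : AddCircle (2 * Real.pi)) := by
  funext i
  by_cases h : i = j
  · subst h; simp [proj]
  · simp [proj, h]

theorem IsClassC.continuous {E : Type*} [NormedAddCommGroup E] [NormedSpace ℝ E] {m : ℕ∞}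
    {g : Torus n → E} (h : IsClassC m g) : Continuous g :=
  (isOpenQuotientMap_proj n).isQuotientMap.continuous_iff.mpr (ContDiff.continuous h)

theorem IsClassC.mono {E : Type*} [NormedAddCommGroup E] [NormedSpace ℝ E] {m m' : ℕ∞}
    {g : Torus n → E} (h : IsClassC m g) (hm : m' ≤ m) : IsClassC m' g :=
  ContDiff.of_le h (by exact_mod_cast hm)

theorem IsClassC.partialDeriv {m : ℕ∞} {φ : Torus n → ℝ} (h : IsClassC (m + 1) φ) (j : Fin n) :
    IsClassC m (partialDeriv j φ) := by
  have hd : Differentiable ℝ (fun x : Fin n → ℝ => φ (proj n x)) :=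
    ContDiff.differentiable h (by simp)
  have heq : (fun x : Fin n → ℝ => Torus.partialDeriv j φ (proj n x)) = fun x =>
      fderiv ℝ (fun y : Fin n → ℝ => φ (proj n y)) x (Pi.single j 1) := by
    funext x
    rw [partialDeriv_proj, (hd x).lineDeriv_eq_fderiv]
  unfold IsClassC
  rw [heq]
  exact (ContDiff.fderiv_right h (by simp)).clm_apply contDiff_const

theorem IsClassC.hasDerivAt {φ : Torus n → ℝ} (h : IsClassC 1 φ) (j : Fin n) (x : Torus n)
    (t : ℝ) :
    HasDerivAt (fun s : ℝ => φ (x + Pi.single j (s : AddCircle (2 * Real.pi))))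
      (Torus.partialDeriv j φ (x + Pi.single j (t : AddCircle (2 * Real.pi)))) t := by
  obtain ⟨y, rfl⟩ := (isOpenQuotientMap_proj n).surjective x
  have hd : Differentiable ℝ (fun x : Fin n → ℝ => φ (proj n x)) :=
    ContDiff.differentiable h (by simp)
  simp only [← proj_add_smul_single]
  rw [partialDeriv_proj, (hd _).lineDeriv_eq_fderiv]
  have h1 : HasDerivAt (fun s : ℝ => y + s • (Pi.single j 1 : Fin n → ℝ)) (Pi.single j 1) t := by
    simpa using ((hasDerivAt_id t).smul_const (Pi.single j 1 : Fin n → ℝ)).const_add y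
  exact (hd _).hasFDerivAt.comp_hasDerivAt t h1

theorem exists_norm_le_of_continuous {E : Type*} [NormedAddCommGroup E] {u : Torus n → E}
    (h : Continuous u) : ∃ C, ∀ x, ‖u x‖ ≤ C := by
  obtain ⟨C, hC⟩ := isCompact_univ.exists_bound_of_continuousOn h.continuousOn
  exact ⟨C, fun x => hC x (Set.mem_univ x)⟩

theorem memLp_of_continuous {E : Type*} [NormedAddCommGroup E] {u : Torus n → E}
    (h : Continuous u) (p : ℝ≥0∞) : MemLp u p := by
  obtain ⟨C, hC⟩ := exists_norm_le_of_continuous h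
  exact MemLp.of_bound (h.aestronglyMeasurable_of_compactSpace) C (.of_forall hC)

/-- Fourier coefficients of a translate. -/
theorem scalarCoeff_translate (u : Torus n → ℂ) (k : Fin n → ℤ) (j : Fin n) (t : ℝ) :
    scalarCoeff (fun x => u (x + Pi.single j (t : AddCircle (2 * Real.pi)))) k =
      Complex.exp (Complex.I * k j * t) * scalarCoeff u k := by
  have h := integral_add_right_eq_self (μ := (volume : Measure (Torus n)))
    (fun x => u x * char (-k) x) (Pi.single j (t : AddCircle (2 * Real.pi)))
  simp only [char_add_right, char_single_coe] at h
  rw [scalarCoeff, scalarCoeff, ← h, mul_left_comm,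
    ← integral_const_mul (Complex.exp _)]
  congr 2
  funext x
  have : Complex.exp (Complex.I * k j * t) * Complex.exp (Complex.I * ((-k) j : ℤ) * t) = 1 := by
    rw [← Complex.exp_add]
    simp
  linear_combination (-(u (x + Pi.single j (t : AddCircle (2 * Real.pi))) * char (-k) x)) * this

/-- Takes the place of integration by parts: the coefficient of the translate by `t` along `e_j` is
differentiated at `t = 0`, once under the integral sign and once through the factor `e^{i k_j t}`.
-/
theorem scalarCoeff_partialDeriv {φ : Torus n → ℝ} (h : IsClassC 1 φ) (j : Fin n)
    (k : Fin n → ℤ) :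
    scalarCoeff (fun x => (partialDeriv j φ x : ℂ)) k =
      Complex.I * k j * scalarCoeff (fun x => (φ x : ℂ)) k := by
  have hc : Continuous (partialDeriv j φ) :=
    (IsClassC.partialDeriv (m := 0) (by simpa using h) j).continuous
  obtain ⟨C, hC⟩ := exists_norm_le_of_continuous hc
  have hφ := h.continuous
  have key := (hasDerivAt_integral_of_dominated_loc_of_deriv_le
    (μ := (volume : Measure (Torus n))) (x₀ := (0 : ℝ)) (s := Set.univ) (bound := fun _ => C)
    (F := fun (t : ℝ) x =>
      (φ (x + Pi.single j (t : AddCircle (2 * Real.pi))) : ℂ) * char (-k) x)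
    (F' := fun (t : ℝ) x =>
      (partialDeriv j φ (x + Pi.single j (t : AddCircle (2 * Real.pi))) : ℂ) * char (-k) x)
    Filter.univ_mem ?_ ?_ ?_ ?_ (integrable_const C) ?_).2
  · have h2 : HasDerivAt (fun t : ℝ => scalarCoeff (fun x =>
        (φ (x + Pi.single j (t : AddCircle (2 * Real.pi))) : ℂ)) k)
        (scalarCoeff (fun x => (partialDeriv j φ x : ℂ)) k) 0 := by
      have := key.const_mul (((2 * Real.pi) ^ n)⁻¹ : ℂ)
      simpa [scalarCoeff] using this
    have h3 : HasDerivAt (fun t : ℝ => Complex.exp (Complex.I * k j * t) *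
        scalarCoeff (fun x => (φ x : ℂ)) k)
        (Complex.I * k j * scalarCoeff (fun x => (φ x : ℂ)) k) 0 := by
      have h4 : HasDerivAt (fun t : ℝ => Complex.I * k j * (t : ℂ)) (Complex.I * k j) 0 := by
        simpa using (Complex.ofRealCLM.hasDerivAt (x := (0 : ℝ))).const_mul (Complex.I * k j)
      simpa using h4.cexp.mul_const (scalarCoeff (fun x => (φ x : ℂ)) k)
    have h5 : (fun t : ℝ => scalarCoeff (fun x =>
        (φ (x + Pi.single j (t : AddCircle (2 * Real.pi))) : ℂ)) k) = fun t : ℝ =>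
        Complex.exp (Complex.I * k j * t) * scalarCoeff (fun x => (φ x : ℂ)) k :=
      funext fun t => scalarCoeff_translate (fun x => (φ x : ℂ)) k j t
    rw [h5] at h2
    exact h2.unique h3
  · refine .of_forall fun t => Continuous.aestronglyMeasurable_of_compactSpace ?_
    have := continuous_char (-k)
    fun_prop
  · refine (memLp_of_continuous ?_ 1).integrable le_rfl
    have := continuous_char (-k)
    fun_prop
  · refine Continuous.aestronglyMeasurable_of_compactSpace ?_
    have := continuous_char (-k)
    fun_prop
  · refine .of_forall fun x t _ => ?_
    rw [norm_mul, norm_char, mul_one, Complex.norm_real]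
    exact hC _
  · exact .of_forall fun x t _ => ((h.hasDerivAt j x t).ofReal_comp).mul_const _

theorem IsClassC.iterate_partialDeriv {m : ℕ∞} {φ : Torus n → ℝ} (j : Fin n) (r : ℕ)
    (h : IsClassC (m + r) φ) :
    IsClassC m ((Torus.partialDeriv j)^[r] φ) ∧ ∀ k,
      scalarCoeff (fun x => ((Torus.partialDeriv j)^[r] φ x : ℂ)) k =
        (Complex.I * k j) ^ r * scalarCoeff (fun x => (φ x : ℂ)) k := by
  induction r generalizing m with
  | zero => simpa using h
  | succ r ih =>
    obtain ⟨h1, h2⟩ := ih (m := m + 1) (by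
      rw [add_assoc, add_comm (1 : ℕ∞)]
      exact_mod_cast h)
    simp only [Function.iterate_succ_apply']
    refine ⟨h1.partialDeriv j, fun k => ?_⟩
    rw [scalarCoeff_partialDeriv (h1.mono (by simp)), h2]
    ring

/-- The Fourier multiplier of `∂^α`. -/
noncomputable def multiplier (α : Fin n → ℕ) (k : Fin n → ℤ) : ℂ := ∏ j, (Complex.I * k j) ^ α j

theorem IsClassC.multiDeriv {φ : Torus n → ℝ} (h : IsClassC ⊤ φ) (α : Fin n → ℕ) :
    IsClassC ⊤ (multiDeriv α φ) ∧ ∀ k,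
      scalarCoeff (fun x => (Torus.multiDeriv α φ x : ℂ)) k =
        multiplier α k * scalarCoeff (fun x => (φ x : ℂ)) k := by
  have key : ∀ l : List (Fin n),
      IsClassC ⊤ (l.foldr (fun j ψ => (Torus.partialDeriv j)^[α j] ψ) φ) ∧ ∀ k,
      scalarCoeff (fun x => ((l.foldr (fun j ψ => (Torus.partialDeriv j)^[α j] ψ) φ x : ℝ) : ℂ)) k =
        (l.map fun j => (Complex.I * k j) ^ α j).prod * scalarCoeff (fun x => (φ x : ℂ)) k := by
    intro l
    induction l with
    | nil => simpa using h
    | cons j l ih =>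
      obtain ⟨h1, h2⟩ := IsClassC.iterate_partialDeriv (m := ⊤) j (α j) (by simpa using ih.1)
      refine ⟨h1, fun k => ?_⟩
      simp only [List.foldr_cons, List.map_cons, List.prod_cons]
      rw [h2, ih.2, mul_assoc]
  refine ⟨(key _).1, fun k => ?_⟩
  rw [multiplier, ← List.prod_ofFn, List.ofFn_eq_map]
  exact (key _).2 k

/-! ### Derivatives of trigonometric functions -/

theorem isClassC_char (m : ℕ∞) (k : Fin n → ℤ) : IsClassC m (char k) := by
  unfold IsClassC
  simp only [char_proj]
  have : ∀ j : Fin n, ContDiff ℝ m (fun x : Fin n → ℝ => ((x j : ℝ) : ℂ)) := fun j =>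
    Complex.ofRealCLM.contDiff.comp (contDiff_apply ℝ ℝ j)
  exact (contDiff_const.mul (ContDiff.sum fun j _ => contDiff_const.mul (this j))).cexp

/-- Test functions are real-valued, so exponentials enter only as `Re (c e^{i⟨k,x⟩})`; varying `c`
recovers real and imaginary parts. -/
theorem isClassC_re_mul_char (m : ℕ∞) (c : ℂ) (k : Fin n → ℤ) :
    IsClassC m fun x => (c * char k x).re :=
  Complex.reCLM.contDiff.comp (contDiff_const.mul (isClassC_char m k))

theorem partialDeriv_re_mul_char (c : ℂ) (k : Fin n → ℤ) (j : Fin n) :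
    partialDeriv j (fun x => (c * char k x).re) = fun x => (Complex.I * k j * c * char k x).re := by
  funext x
  unfold partialDeriv
  simp only [char_add_right, char_single_coe]
  have h4 : HasDerivAt (fun t : ℝ => Complex.I * k j * (t : ℂ)) (Complex.I * k j) 0 := by
    simpa using (Complex.ofRealCLM.hasDerivAt (x := (0 : ℝ))).const_mul (Complex.I * k j)
  have h5 : HasDerivAt (fun t : ℝ => c * (char k x * Complex.exp (Complex.I * k j * t)))
      (Complex.I * k j * c * char k x) 0 := by
    convert! (h4.cexp.const_mul (char k x)).const_mul c using 1
    simp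
    ring
  exact (Complex.reCLM.hasFDerivAt.comp_hasDerivAt _ h5).deriv

theorem iterate_partialDeriv_re_mul_char (c : ℂ) (k : Fin n → ℤ) (j : Fin n) (r : ℕ) :
    (partialDeriv j)^[r] (fun x => (c * char k x).re) =
      fun x => ((Complex.I * k j) ^ r * c * char k x).re := by
  induction r with
  | zero => simp
  | succ r ih =>
    rw [Function.iterate_succ_apply', ih, partialDeriv_re_mul_char]
    funext x
    congr 2
    ring

theorem multiDeriv_re_mul_char (α : Fin n → ℕ) (c : ℂ) (k : Fin n → ℤ) :
    multiDeriv α (fun x => (c * char k x).re) = fun x => (multiplier α k * c * char k x).re := by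
  have key : ∀ l : List (Fin n),
      l.foldr (fun j ψ => (partialDeriv j)^[α j] ψ) (fun x => (c * char k x).re) =
        fun x => ((l.map fun j => (Complex.I * k j) ^ α j).prod * c * char k x).re := by
    intro l
    induction l with
    | nil => simp
    | cons j l ih =>
      rw [List.foldr_cons, ih, iterate_partialDeriv_re_mul_char]
      simp only [List.map_cons, List.prod_cons, mul_assoc]
  rw [multiplier, ← List.prod_ofFn, List.ofFn_eq_map]
  exact key _

/-! ### Frequencies and shells -/

theorem freq_nonneg (k : Fin n → ℤ) : 0 ≤ freq k := Finset.sum_nonneg fun _ _ => abs_nonneg _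

theorem freq_neg (k : Fin n → ℤ) : freq (-k) = freq k := by simp [freq]

theorem freq_zero : freq (0 : Fin n → ℤ) = 0 := by simp [freq]

theorem abs_le_freq (k : Fin n → ℤ) (j : Fin n) : |(k j : ℝ)| ≤ freq k :=
  Finset.single_le_sum (f := fun j => |(k j : ℝ)|) (fun _ _ => abs_nonneg _) (Finset.mem_univ j)

theorem one_le_freq {k : Fin n → ℤ} (hk : k ≠ 0) : 1 ≤ freq k := by
  obtain ⟨j, hj⟩ := Function.ne_iff.mp hk
  refine le_trans ?_ (abs_le_freq k j)
  exact_mod_cast Int.one_le_abs hj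

theorem exists_mem_shell {b : ℕ} (hb : 2 ≤ b) {k : Fin n → ℤ} (hk : k ≠ 0) :
    ∃ ν, k ∈ shell n b ν := by
  have hb1 : (1 : ℝ) < b := by exact_mod_cast hb
  obtain ⟨m, hm1, hm2⟩ := exists_mem_Ioc_zpow (zero_lt_one.trans_le (one_le_freq hk)) hb1
  -- Since `|k| ≥ 1`, the exponent cannot be negative; the shell `ν = 0` accounts for `|k| = 1`.
  have hm : 0 ≤ m + 1 := by
    by_contra! h
    have := zpow_lt_one_of_neg₀ hb1 h
    linarith [one_le_freq hk]
  obtain ⟨ν, hν⟩ := Int.eq_ofNat_of_zero_le hm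
  refine ⟨ν, ?_, ?_⟩
  · rwa [← eq_sub_of_add_eq hν]
  · rw [hν] at hm2
    exact_mod_cast hm2

theorem ne_zero_of_mem_shell {b ν : ℕ} (hb : 2 ≤ b) {k : Fin n → ℤ} (hk : k ∈ shell n b ν) :
    k ≠ 0 := by
  rintro rfl
  have h := hk.1
  rw [freq_zero] at h
  have : (0 : ℝ) < b := by positivity
  linarith [zpow_pos this ((ν : ℤ) - 1)]

/-- Only an upper bound is needed, so covering suffices and disjointness of the shells plays no
role. The zero frequency lies in no shell. -/
theorem tsum_le_tsum_shell {b : ℕ} (hb : 2 ≤ b) (w : (Fin n → ℤ) → ℝ≥0∞) :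
    ∑' k, w k ≤ w 0 + ∑' ν : ℕ, ∑' k : shell n b ν, w k := by
  have hsub : (Set.univ : Set (Fin n → ℤ)) ⊆ {0} ∪ ⋃ ν, shell n b ν := by
    intro k _
    by_cases hk : k = 0
    · exact Or.inl hk
    · exact Or.inr (Set.mem_iUnion.mpr (exists_mem_shell hb hk))
  calc ∑' k, w k = ∑' k : (Set.univ : Set (Fin n → ℤ)), w k := (tsum_univ w).symm
    _ ≤ ∑' k : ({0} ∪ ⋃ ν, shell n b ν : Set (Fin n → ℤ)), w k := ENNReal.tsum_mono_subtype w hsub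
    _ ≤ ∑' k : ({0} : Set (Fin n → ℤ)), w k + ∑' k : (⋃ ν, shell n b ν : Set (Fin n → ℤ)), w k :=
        ENNReal.tsum_union_le w _ _
    _ ≤ _ := by
        rw [tsum_singleton]
        gcongr
        exact ENNReal.tsum_iUnion_le_tsum w _

/-- The shell sits in a box of `(2 b^ν + 1)^n ≤ (3 b^ν)^n` lattice points. -/
theorem tsum_shell_le {b ν : ℕ} (hb : 2 ≤ b) {w : (Fin n → ℤ) → ℝ≥0∞} {C : ℝ≥0∞}
    (h : ∀ k ∈ shell n b ν, w k ≤ C) :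
    ∑' k : shell n b ν, w k ≤ (((3 * b ^ ν) ^ n : ℕ) : ℝ≥0∞) * C := by
  let Q : Finset (Fin n → ℤ) :=
    Fintype.piFinset fun _ => Finset.Icc (-(b ^ ν : ℕ) : ℤ) (b ^ ν : ℕ)
  have hsub : shell n b ν ⊆ (Q : Set (Fin n → ℤ)) := by
    intro k hk
    rw [Finset.mem_coe, Fintype.mem_piFinset]
    intro j
    have h1 : |(k j : ℝ)| ≤ (b : ℝ) ^ ν := (abs_le_freq k j).trans hk.2
    have h2 : |k j| ≤ (b ^ ν : ℕ) := by exact_mod_cast h1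
    rw [Finset.mem_Icc]
    exact abs_le.mp h2
  have hcard : Q.card ≤ (3 * b ^ ν) ^ n := by
    have hpos : 1 ≤ b ^ ν := Nat.one_le_pow _ _ (by omega)
    rw [Fintype.card_piFinset, Finset.prod_const, Finset.card_univ, Fintype.card_fin, Int.card_Icc]
    gcongr
    omega
  calc ∑' k : shell n b ν, w k ≤ ∑' k : shell n b ν, C := ENNReal.tsum_le_tsum fun k => h k k.2
    _ ≤ ∑' k : (Q : Set (Fin n → ℤ)), C := ENNReal.tsum_mono_subtype (fun _ => C) hsub
    _ = Q.card * C := by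
        rw [Finset.tsum_subtype' Q (fun _ => C), Finset.sum_const, nsmul_eq_mul]
    _ ≤ _ := by gcongr

/-- Point count times the largest term; the factor `b^q` comes from the lower edge `b^(ν-1)`. It is
used at `q = n`, where the bound is uniform in `ν`, and at `q > n`, where it decays geometrically.
-/
theorem tsum_shell_rpow_le {b : ℕ} (hb : 2 ≤ b) (ν : ℕ) {q : ℝ} (hq : 0 ≤ q) :
    ∑' k : shell n b ν, ENNReal.ofReal (freq (k : Fin n → ℤ) ^ (-q)) ≤
      ENNReal.ofReal (3 ^ n * (b : ℝ) ^ q * ((b : ℝ) ^ (n - q)) ^ ν) := by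
  have hb0 : (0 : ℝ) < b := by positivity
  refine (tsum_shell_le hb (w := fun k => ENNReal.ofReal (freq k ^ (-q)))
    (C := ENNReal.ofReal (((b : ℝ) ^ ((ν : ℤ) - 1)) ^ (-q)))
    fun k hk => ?_).trans_eq ?_
  · refine ENNReal.ofReal_le_ofReal ?_
    exact Real.rpow_le_rpow_of_nonpos (zpow_pos hb0 _) hk.1.le (by linarith)
  · rw [← ENNReal.ofReal_natCast, ← ENNReal.ofReal_mul (by positivity)]
    congr 1
    push_cast
    rw [mul_pow, mul_assoc, mul_assoc]
    congr 1
    rw [← Real.rpow_natCast ((b : ℝ) ^ (n - q)), ← Real.rpow_intCast, ← Real.rpow_natCast _ n,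
      ← Real.rpow_natCast _ ν, ← Real.rpow_mul hb0.le, ← Real.rpow_mul hb0.le,
      ← Real.rpow_mul hb0.le, ← Real.rpow_add hb0, ← Real.rpow_add hb0]
    congr 1
    push_cast
    ring

/-! ### Summability in Pöschel's space -/

theorem _root_.ENNReal.tsum_mul_le_sqrt_mul_sqrt {ι : Type*} (f g : ι → ℝ≥0∞) :
    ∑' i, f i * g i ≤ (∑' i, f i ^ 2) ^ (1 / 2 : ℝ) * (∑' i, g i ^ 2) ^ (1 / 2 : ℝ) := by
  rw [ENNReal.tsum_eq_iSup_sum]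
  refine iSup_le fun s => ?_
  refine (ENNReal.inner_le_Lp_mul_Lq s f g Real.HolderConjugate.two_two).trans ?_
  simp only [ENNReal.rpow_two]
  gcongr
  · exact ENNReal.sum_le_tsum s
  · exact ENNReal.sum_le_tsum s

/-- This is `ℓ¹ ⊆ ℓ²` for the square roots: each one is at most their total. -/
theorem _root_.ENNReal.tsum_lt_top_of_tsum_sqrt {ι : Type*} {f : ι → ℝ≥0∞}
    (h : ∑' i, f i ^ (1 / 2 : ℝ) < ⊤) : ∑' i, f i < ⊤ := by
  have h1 : ∀ i, f i ≤ (∑' i, f i ^ (1 / 2 : ℝ)) * f i ^ (1 / 2 : ℝ) := by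
    intro i
    calc f i = f i ^ (1 / 2 : ℝ) * f i ^ (1 / 2 : ℝ) := by
          rw [← ENNReal.rpow_add_of_nonneg _ _ (by norm_num) (by norm_num)]
          norm_num
      _ ≤ _ := by
          gcongr
          exact ENNReal.le_tsum i
  refine (ENNReal.tsum_le_tsum h1).trans_lt ?_
  rw [ENNReal.tsum_mul_left]
  exact ENNReal.mul_lt_top h h

theorem _root_.summable_of_tsum_ofReal_lt_top {ι : Type*} {f : ι → ℝ} (hf : ∀ i, 0 ≤ f i)
    (h : ∑' i, ENNReal.ofReal (f i) < ⊤) : Summable f := by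
  refine (ENNReal.summable_toReal h.ne).congr fun i => ?_
  rw [ENNReal.toReal_ofReal (hf i)]

theorem norm_scalarCoeff_le (f : Torus n → EuclideanSpace ℝ (Fin n)) (i : Fin n)
    (k : Fin n → ℤ) : ‖scalarCoeff (fun x => (f x i : ℂ)) k‖ ≤ ‖fourierCoeff f k‖ :=
  PiLp.norm_apply_le (fourierCoeff f k) i

theorem summable_rpow_mul_sq {τ : ℝ} {b : ℕ} (hb : 2 ≤ b)
    {f : Torus n → EuclideanSpace ℝ (Fin n)} (hf : poschelNorm τ b f < ⊤) (i : Fin n) :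
    Summable fun k => freq k ^ (2 * τ + 2) * ‖scalarCoeff (fun x => (f x i : ℂ)) k‖ ^ 2 := by
  have hfreq := freq_nonneg (n := n)
  refine summable_of_tsum_ofReal_lt_top (fun k => by have := hfreq k; positivity) ?_
  refine (tsum_le_tsum_shell hb _).trans_lt
    (ENNReal.add_lt_top.mpr ⟨ENNReal.ofReal_lt_top, ?_⟩)
  refine (ENNReal.tsum_le_tsum fun ν => ENNReal.tsum_le_tsum fun k => ?_).trans_lt
    (ENNReal.tsum_lt_top_of_tsum_sqrt hf)
  refine ENNReal.ofReal_le_ofReal ?_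
  rw [mul_comm]
  have := hfreq k
  gcongr
  exact norm_scalarCoeff_le f i k

/-- Cauchy–Schwarz on each shell, splitting `|k|^m ≤ |k|^{τ+1} |k|^{-n/2}`. The second factor is
bounded uniformly in `ν`, so the `ℓ¹` summation over shells in the norm is exactly what admits the
endpoint `m = τ + 1 - n/2`. -/
theorem summable_rpow_mul {τ : ℝ} {b : ℕ} (hb : 2 ≤ b)
    {f : Torus n → EuclideanSpace ℝ (Fin n)} (hf : poschelNorm τ b f < ⊤) {m : ℝ}
    (hm : m ≤ τ + 1 - n / 2) (i : Fin n) :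
    Summable fun k => freq k ^ m * ‖scalarCoeff (fun x => (f x i : ℂ)) k‖ := by
  have hfreq := freq_nonneg (n := n)
  refine summable_of_tsum_ofReal_lt_top (fun k => by have := hfreq k; positivity) ?_
  refine (tsum_le_tsum_shell hb _).trans_lt
    (ENNReal.add_lt_top.mpr ⟨ENNReal.ofReal_lt_top, ?_⟩)
  have hshell : ∀ ν, ∑' k : shell n b ν,
      ENNReal.ofReal (freq (k : Fin n → ℤ) ^ m * ‖scalarCoeff (fun x => (f x i : ℂ)) k‖) ≤
      (∑' k : shell n b ν, ENNReal.ofReal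
        (‖fourierCoeff f k‖ ^ 2 * freq (k : Fin n → ℤ) ^ (2 * τ + 2))) ^ (1 / 2 : ℝ) *
      (ENNReal.ofReal (3 ^ n * (b : ℝ) ^ (n : ℝ))) ^ (1 / 2 : ℝ) := by
    intro ν
    have hsq : ∀ k : shell n b ν,
        ENNReal.ofReal (freq (k : Fin n → ℤ) ^ m * ‖scalarCoeff (fun x => (f x i : ℂ)) k‖) ≤
        ENNReal.ofReal (‖fourierCoeff f k‖ * freq (k : Fin n → ℤ) ^ (τ + 1)) *
          ENNReal.ofReal (freq (k : Fin n → ℤ) ^ (-(n / 2 : ℝ))) := by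
      intro k
      have hk1 := one_le_freq (ne_zero_of_mem_shell hb k.2)
      have hk0 : 0 < freq (k : Fin n → ℤ) := by linarith
      rw [← ENNReal.ofReal_mul (by positivity), mul_assoc, ← Real.rpow_add hk0, mul_comm]
      refine ENNReal.ofReal_le_ofReal ?_
      gcongr
      · exact norm_scalarCoeff_le f i k
      · linarith
    refine (ENNReal.tsum_le_tsum hsq).trans ((ENNReal.tsum_mul_le_sqrt_mul_sqrt _ _).trans ?_)
    gcongr with k
    · have hk0 := hfreq k
      rw [← ENNReal.ofReal_pow (by positivity), mul_pow, ← Real.rpow_mul_natCast hk0]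
      refine le_of_eq ?_
      congr 3
      push_cast
      ring
    · have h := tsum_shell_rpow_le (n := n) hb ν (q := n) (by positivity)
      rw [sub_self, Real.rpow_zero, one_pow, mul_one] at h
      refine le_trans (le_of_eq ?_) h
      refine tsum_congr fun k => ?_
      have hk0 := hfreq k
      rw [← ENNReal.ofReal_pow (by positivity), ← Real.rpow_mul_natCast hk0]
      congr 2
      push_cast
      ring
  refine (ENNReal.tsum_le_tsum hshell).trans_lt ?_
  rw [ENNReal.tsum_mul_right]
  exact ENNReal.mul_lt_top hf (ENNReal.rpow_lt_top_of_nonneg (by norm_num) ENNReal.ofReal_ne_top)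

/-- Membership criterion for the extremal map: under this decay the shell norms are `O(b^{-εν})`. -/
theorem poschelNorm_lt_top_of_le {τ ε C : ℝ} {b : ℕ} (hb : 2 ≤ b) (hε : 0 < ε) (hC : 0 ≤ C)
    {f : Torus n → EuclideanSpace ℝ (Fin n)}
    (hf : ∀ k ≠ 0, ‖fourierCoeff f k‖ ^ 2 ≤ C * freq k ^ (-(2 * τ + 2 + n + 2 * ε))) :
    poschelNorm τ b f < ⊤ := by
  have hb1 : (1 : ℝ) < b := by exact_mod_cast hb
  have hb0 : (0 : ℝ) < b := by positivity
  have hshell : ∀ ν, (∑' k : shell n b ν, ENNReal.ofReal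
        (‖fourierCoeff f k‖ ^ 2 * freq (k : Fin n → ℤ) ^ (2 * τ + 2))) ^ (1 / 2 : ℝ) ≤
      ENNReal.ofReal ((C * (3 ^ n * (b : ℝ) ^ (n + 2 * ε))) ^ (1 / 2 : ℝ) *
        ((b : ℝ) ^ (-ε)) ^ ν) := by
    intro ν
    have h1 : ∀ k : shell n b ν,
        ENNReal.ofReal (‖fourierCoeff f k‖ ^ 2 * freq (k : Fin n → ℤ) ^ (2 * τ + 2)) ≤
        ENNReal.ofReal C * ENNReal.ofReal (freq (k : Fin n → ℤ) ^ (-(n + 2 * ε))) := by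
      intro k
      have hk := ne_zero_of_mem_shell hb k.2
      have hk0 : 0 < freq (k : Fin n → ℤ) := by linarith [one_le_freq hk]
      rw [← ENNReal.ofReal_mul hC]
      refine ENNReal.ofReal_le_ofReal ?_
      calc _ ≤ C * freq (k : Fin n → ℤ) ^ (-(2 * τ + 2 + n + 2 * ε)) *
            freq (k : Fin n → ℤ) ^ (2 * τ + 2) := by
            gcongr
            exact hf k hk
        _ = _ := by
            rw [mul_assoc, ← Real.rpow_add hk0]
            congr 2
            ring
    have h2 := tsum_shell_rpow_le (n := n) hb ν (q := n + 2 * ε) (by positivity)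
    calc _ ≤ (ENNReal.ofReal C * ENNReal.ofReal
          (3 ^ n * (b : ℝ) ^ (n + 2 * ε) * ((b : ℝ) ^ (n - (n + 2 * ε))) ^ ν)) ^ (1 / 2 : ℝ) := by
          gcongr
          refine (ENNReal.tsum_le_tsum h1).trans ?_
          rw [ENNReal.tsum_mul_left]
          gcongr
      _ = _ := by
          rw [← ENNReal.ofReal_mul hC, ENNReal.ofReal_rpow_of_nonneg (by positivity) (by norm_num)]
          congr 1
          rw [← mul_assoc, Real.mul_rpow (by positivity) (by positivity)]
          congr 1
          rw [← Real.rpow_natCast, ← Real.rpow_natCast, ← Real.rpow_mul hb0.le,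
            ← Real.rpow_mul hb0.le, ← Real.rpow_mul hb0.le]
          congr 1
          ring
  refine (ENNReal.tsum_le_tsum hshell).trans_lt ?_
  refine Summable.tsum_ofReal_lt_top (Summable.mul_left _ ?_)
  refine summable_geometric_of_lt_one (by positivity) ?_
  exact Real.rpow_lt_one_of_one_lt_of_neg hb1 (by linarith)

/-! ### Existence of weak derivatives -/

theorem norm_multiplier (α : Fin n → ℕ) (k : Fin n → ℤ) :
    ‖multiplier α k‖ = ∏ j, |(k j : ℝ)| ^ α j := by
  simp [multiplier, norm_prod]

theorem norm_multiplier_le (α : Fin n → ℕ) (k : Fin n → ℤ) :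
    ‖multiplier α k‖ ≤ freq k ^ ∑ j, α j := by
  rw [norm_multiplier, ← Finset.prod_pow_eq_pow_sum]
  gcongr with j
  exact abs_le_freq k j

theorem conj_multiplier (α : Fin n → ℕ) (k : Fin n → ℤ) :
    conj (multiplier α k) = (-1) ^ (∑ j, α j) * multiplier α k := by
  rw [multiplier, map_prod, ← Finset.prod_pow_eq_pow_sum, ← Finset.prod_mul_distrib]
  refine Finset.prod_congr rfl fun j _ => ?_
  rw [map_pow, map_mul, Complex.conj_I, ← mul_pow]
  simp

theorem multiplier_neg (α : Fin n → ℕ) (k : Fin n → ℤ) :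
    multiplier α (-k) = (-1) ^ (∑ j, α j) * multiplier α k := by
  rw [multiplier, ← Finset.prod_pow_eq_pow_sum, multiplier, ← Finset.prod_mul_distrib]
  refine Finset.prod_congr rfl fun j _ => ?_
  rw [← mul_pow]
  simp

theorem memLp_ofReal_apply {f : Torus n → EuclideanSpace ℝ (Fin n)} (hf : MemLp f 2) (i : Fin n) :
    MemLp (fun x => (f x i : ℂ)) 2 :=
  (hf.eval_piLp i).ofReal

theorem integrable_smul_apply {φ : Torus n → ℝ} (hφ : Continuous φ)
    {f : Torus n → EuclideanSpace ℝ (Fin n)} (hf : MemLp f 2) (i : Fin n) :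
    Integrable (fun x => (φ x • f x) i) := by
  have h := MemLp.integrable_mul (memLp_of_continuous hφ 2) (hf.eval_piLp i)
  exact h

/-- Parseval on both sides; the sign is the one produced by conjugating the multiplier. -/
theorem integral_mul_eq_of_scalarCoeff {φ ψ : Torus n → ℝ} {u v : Torus n → ℂ} {α : Fin n → ℕ}
    (hφ : Continuous φ) (hψ : Continuous ψ) (hu : MemLp u 2) (hv : MemLp v 2)
    (h1 : ∀ k, scalarCoeff (fun x => (ψ x : ℂ)) k =
      multiplier α k * scalarCoeff (fun x => (φ x : ℂ)) k)
    (h2 : ∀ k, scalarCoeff v k = multiplier α k * scalarCoeff u k) :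
    ∫ x, (ψ x : ℂ) * u x = (-1) ^ (∑ j, α j) * ∫ x, (φ x : ℂ) * v x := by
  have e1 := hasSum_conj_scalarCoeff_mul (memLp_of_continuous
    (Complex.continuous_ofReal.comp hψ) 2) hu
  have e2 := (hasSum_conj_scalarCoeff_mul (memLp_of_continuous
    (Complex.continuous_ofReal.comp hφ) 2) hv).mul_left ((-1 : ℂ) ^ (∑ j, α j))
  simp only [Function.comp_def, Complex.conj_ofReal, h1, h2, map_mul, conj_multiplier] at e1 e2
  have e3 := e1.unique (e2.congr_fun ?_)
  · rw [mul_left_comm] at e3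
    exact mul_left_cancel₀ (inv_ne_zero (two_pi_pow_ne_zero n)) e3
  · intro k
    ring

theorem exists_isWeakDeriv {f : Torus n → EuclideanSpace ℝ (Fin n)} (hf : MemLp f 2)
    (α : Fin n → ℕ)
    (h : ∀ i, Summable fun k => ‖multiplier α k * scalarCoeff (fun x => (f x i : ℂ)) k‖ ^ 2) :
    ∃ g, IsWeakDeriv α f g := by
  choose G hG hGc using fun i => exists_scalarCoeff_eq (h i)
  -- Riesz–Fischer yields complex functions `G i`. Since `f` and the test functions are real, taking
  -- real parts preserves the identity to be proved.
  have hg : MemLp (fun x => WithLp.toLp 2 fun i => (G i x).re :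
      Torus n → EuclideanSpace ℝ (Fin n)) 2 := MemLp.of_eval_piLp fun i => (hG i).re
  refine ⟨_, hg, fun φ hφ => ?_⟩
  have hd := IsClassC.multiDeriv hφ α
  ext i
  rw [eval_integral_piLp fun i => integrable_smul_apply hd.1.continuous hf i, PiLp.smul_apply,
    eval_integral_piLp fun i => integrable_smul_apply hφ.continuous hg i]
  have key := integral_mul_eq_of_scalarCoeff hφ.continuous hd.1.continuous
    (memLp_ofReal_apply hf i) (hG i) hd.2 (hGc i)
  have hint : Integrable (fun x => (φ x : ℂ) * G i x) :=
    MemLp.integrable_mul (memLp_of_continuous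
      (Complex.continuous_ofReal.comp hφ.continuous) 2) (hG i)
  have key2 := congr_arg Complex.re key
  have e1 : ∫ x, ((multiDeriv α φ x : ℝ) : ℂ) * (f x i : ℂ) =
      ((∫ x, multiDeriv α φ x * f x i : ℝ) : ℂ) := by
    rw [← integral_complex_ofReal]
    simp
  have e2 : (∫ x, (φ x : ℂ) * G i x).re = ∫ x, φ x * (G i x).re := by
    have := integral_re hint
    simp only [RCLike.re_to_complex, Complex.re_ofReal_mul] at this
    exact this.symm
  have e3 : ((-1 : ℂ) ^ (∑ j, α j)) = (((-1 : ℝ) ^ (∑ j, α j) : ℝ) : ℂ) := by push_cast; rfl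
  rw [e1, e3, Complex.ofReal_re, Complex.re_ofReal_mul, e2] at key2
  exact key2

theorem exists_isWeakDeriv_of_mem_poschelSpace {τ : ℝ} (hτ : 0 ≤ τ) {b : ℕ} (hb : 2 ≤ b)
    {f : Torus n → EuclideanSpace ℝ (Fin n)} (hf : f ∈ poschelSpace n τ b) {α : Fin n → ℕ}
    (hα : ∑ j, α j ≤ ⌊τ⌋₊ + 1) : ∃ g, IsWeakDeriv α f g := by
  refine exists_isWeakDeriv hf.1 α fun i => ?_
  have hα' : ((∑ j, α j : ℕ) : ℝ) ≤ τ + 1 := by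
    refine (Nat.cast_le.mpr hα).trans ?_
    push_cast
    linarith [Nat.floor_le hτ]
  refine Summable.of_norm_bounded_eventually (summable_rpow_mul_sq hb hf.2 i) ?_
  -- The zero frequency is excluded because for `α = 0` the multiplier there is `1` while the weight
  -- `0 ^ (2τ+2)` vanishes.
  filter_upwards [(Set.finite_singleton (0 : Fin n → ℤ)).compl_mem_cofinite] with k hk
  have hk1 : 1 ≤ freq k := one_le_freq hk
  rw [Real.norm_of_nonneg (by positivity), norm_mul, mul_pow]
  gcongr
  calc ‖multiplier α k‖ ^ 2 ≤ (freq k ^ ∑ j, α j) ^ 2 := by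
        gcongr
        exact norm_multiplier_le α k
    _ = freq k ^ (((∑ j, α j : ℕ) : ℝ) * 2) := by
        rw [Real.rpow_mul (by linarith), Real.rpow_natCast, Real.rpow_two]
    _ ≤ _ := Real.rpow_le_rpow_of_exponent_le hk1 (by linarith)

/-! ### Classical differentiability -/

theorem scalarCoeff_char (k l : Fin n → ℤ) : scalarCoeff (char k) l = if k = l then 1 else 0 := by
  simp only [scalarCoeff, ← char_add]
  split_ifs with h
  · subst h
    simp only [add_neg_cancel, char_zero, integral_const, volume_real_univ]
    have := two_pi_pow_ne_zero n
    simp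
  · rw [← sub_eq_add_neg, integral_char_eq_zero (sub_ne_zero.mpr h), mul_zero]

/-- The function is `t ↦ c e^{it}`, whose derivatives all have modulus `‖c‖`, composed with the
linear form `⟨k, ·⟩`. Its norm is at most `∑ |k_j|` because `Fin n → ℝ` carries the sup norm. -/
theorem norm_iteratedFDeriv_char_le (c : ℂ) (k : Fin n → ℤ) (m : ℕ) (x : Fin n → ℝ) :
    ‖iteratedFDeriv ℝ m (fun x => c * char k (proj n x)) x‖ ≤ freq k ^ m * ‖c‖ := by
  let L : (Fin n → ℝ) →L[ℝ] ℝ := ∑ j, (k j : ℝ) • ContinuousLinearMap.proj j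
  have hL : ‖L‖ ≤ freq k := by
    refine (norm_sum_le _ _).trans (Finset.sum_le_sum fun j _ => ?_)
    rw [norm_smul, Real.norm_eq_abs]
    refine mul_le_of_le_one_right (abs_nonneg _) ?_
    exact ContinuousLinearMap.opNorm_le_bound _ zero_le_one fun y => by
      simpa using norm_le_pi_norm y j
  let e : ℝ → ℂ := fun t => c * Complex.exp (Complex.I * t)
  have he : ContDiff ℝ m e :=
    contDiff_const.mul (contDiff_const.mul Complex.ofRealCLM.contDiff).cexp
  have hiter : ∀ m, iteratedDeriv m e = fun t => Complex.I ^ m * e t := by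
    intro m
    induction m with
    | zero => simp
    | succ m ih =>
      rw [iteratedDeriv_succ, ih]
      funext t
      have h4 : HasDerivAt (fun t : ℝ => Complex.I * (t : ℂ)) Complex.I t := by
        simpa using (Complex.ofRealCLM.hasDerivAt (x := t)).const_mul Complex.I
      rw [((h4.cexp.const_mul c).const_mul (Complex.I ^ m)).deriv]
      simp only [e]
      ring
  have hcomp : (fun x => c * char k (proj n x)) = e ∘ L := by
    funext x
    simp [e, L, char_proj]
  rw [hcomp, ContinuousLinearMap.iteratedFDeriv_comp_right L he x le_rfl]
  refine (ContinuousMultilinearMap.norm_compContinuousLinearMap_le _ _).trans ?_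
  rw [norm_iteratedFDeriv_eq_norm_iteratedDeriv, hiter, Finset.prod_const, Finset.card_univ,
    Fintype.card_fin, mul_comm]
  have : ‖Complex.I ^ m * e (L x)‖ = ‖c‖ := by
    simp [e, Complex.norm_exp]
  rw [this]
  gcongr

theorem exists_isClassC_of_summable {u : Torus n → ℂ} (hu : MemLp u 2) {m : ℕ}
    (h0 : Summable fun k => ‖scalarCoeff u k‖)
    (hm : Summable fun k => freq k ^ m * ‖scalarCoeff u k‖) :
    ∃ g : Torus n → ℂ, IsClassC (m : ℕ∞) g ∧ u =ᵐ[volume] g := by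
  let g : Torus n → ℂ := fun x => ∑' k, scalarCoeff u k * char k x
  have hg : IsClassC (m : ℕ∞) g := by
    -- One majorant for all orders `r ≤ m`, from `|k|^r ≤ 1 + |k|^m`; the summand `1` covers `k =
    -- 0`.
    refine contDiff_tsum (v := fun _ k => ‖scalarCoeff u k‖ + freq k ^ m * ‖scalarCoeff u k‖)
      (fun k => contDiff_const.mul (isClassC_char _ k)) (fun _ _ => h0.add hm) fun r k x hr => ?_
    refine (norm_iteratedFDeriv_char_le _ k r x).trans ?_
    have hr' : r ≤ m := by exact_mod_cast hr
    have hk := freq_nonneg k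
    rcases le_total (freq k) 1 with h | h
    · have : freq k ^ r ≤ 1 := pow_le_one₀ hk h
      nlinarith [norm_nonneg (scalarCoeff u k), pow_nonneg hk m,
        mul_nonneg (pow_nonneg hk m) (norm_nonneg (scalarCoeff u k))]
    · have : freq k ^ r ≤ freq k ^ m := pow_le_pow_right₀ h hr'
      nlinarith [norm_nonneg (scalarCoeff u k)]
  refine ⟨g, hg, ae_eq_of_scalarCoeff_eq hu (memLp_of_continuous hg.continuous 2) fun l => ?_⟩
  have hsum := hasSum_integral_of_summable_integral_norm (μ := (volume : Measure (Torus n)))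
    (F := fun k x => scalarCoeff u k * char k x * char (-l) x) (fun k => ?_) ?_
  · have h2 : scalarCoeff g l = ∑' k, scalarCoeff u k * scalarCoeff (char k) l := by
      rw [scalarCoeff]
      simp only [g, ← tsum_mul_right]
      rw [← hsum.tsum_eq, ← tsum_mul_left]
      refine tsum_congr fun k => ?_
      simp only [mul_assoc]
      rw [integral_const_mul, mul_left_comm]
      rfl
    rw [h2, tsum_eq_single l]
    · simp [scalarCoeff_char]
    · intro k hk
      simp [scalarCoeff_char, hk]
  · refine (memLp_of_continuous ?_ 1).integrable le_rfl
    exact (continuous_const.mul (continuous_char k)).mul (continuous_char _)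
  · simp only [norm_mul, norm_char, mul_one, integral_const, smul_eq_mul]
    exact h0.mul_left _

theorem exists_isClassC_of_mem_poschelSpace {τ : ℝ} {b : ℕ} (hb : 2 ≤ b)
    {f : Torus n → EuclideanSpace ℝ (Fin n)} (hf : f ∈ poschelSpace n τ b) {m : ℕ}
    (hm : (m : ℝ) ≤ τ + 1 - n / 2) :
    ∃ g : Torus n → EuclideanSpace ℝ (Fin n), IsClassC (m : ℕ∞) g ∧ f =ᵐ[volume] g := by
  have h : ∀ i, ∃ g : Torus n → ℂ, IsClassC (m : ℕ∞) g ∧ (fun x => (f x i : ℂ)) =ᵐ[volume] g := by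
    intro i
    refine exists_isClassC_of_summable (memLp_ofReal_apply hf.1 i) ?_ ?_
    · have := summable_rpow_mul hb hf.2 (m := 0) (le_trans (by positivity) hm) i
      simpa using this
    · have := summable_rpow_mul hb hf.2 hm i
      simpa using this
  choose g hg hfg using h
  refine ⟨fun x => WithLp.toLp 2 fun i => (g i x).re, ?_, ?_⟩
  · refine contDiff_euclidean.mpr fun i => ?_
    exact Complex.reCLM.contDiff.comp (hg i)
  · filter_upwards [ae_all_iff.mpr hfg] with x hx
    ext i
    simp [← hx i]

theorem scalarCoeff_const_mul (u : Torus n → ℂ) (c : ℂ) (k : Fin n → ℤ) :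
    scalarCoeff (fun x => c * u x) k = c * scalarCoeff u k := by
  simp only [scalarCoeff, mul_assoc]
  rw [integral_const_mul, mul_left_comm]

/-! ### Bounded functions with nonnegative Fourier coefficients -/

/-- The cube of frequencies `k` with `N < k_j ≤ 2N` for all `j`. -/
noncomputable def cube (n N : ℕ) : Finset (Fin n → ℤ) :=
  Fintype.piFinset fun _ => Finset.Ioc (N : ℤ) (2 * N)

theorem integrable_mul_char {u : Torus n → ℂ} (hu : Integrable u) (k : Fin n → ℤ) :
    Integrable (fun x => u x * char k x) :=
  hu.mul_bdd (c := 1) (continuous_char k).aestronglyMeasurable_of_compactSpace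
    (.of_forall fun x => (norm_char k x).le)

theorem integral_mul_normSq_sum_char {u : Torus n → ℂ} (hu : Integrable u)
    (Q : Finset (Fin n → ℤ)) :
    ∫ x, u x * ((‖∑ k ∈ Q, char k x‖ ^ 2 : ℝ) : ℂ) =
      (2 * Real.pi) ^ n * ∑ l ∈ Q, ∑ k ∈ Q, scalarCoeff u (k - l) := by
  have h1 : ∀ x, u x * ((‖∑ k ∈ Q, char k x‖ ^ 2 : ℝ) : ℂ) =
      ∑ l ∈ Q, ∑ k ∈ Q, u x * char (-(k - l)) x := by
    intro x
    rw [← Complex.normSq_eq_norm_sq, Complex.normSq_eq_conj_mul_self, map_sum, Finset.sum_mul_sum,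
      Finset.sum_comm, Finset.mul_sum]
    refine Finset.sum_congr rfl fun l _ => ?_
    rw [Finset.mul_sum]
    refine Finset.sum_congr rfl fun k _ => ?_
    rw [neg_sub, sub_eq_add_neg, char_add, char_neg]
    ring
  simp only [h1]
  rw [integral_finsetSum _ fun l _ => integrable_finsetSum _ fun k _ => integrable_mul_char hu _,
    Finset.mul_sum]
  refine Finset.sum_congr rfl fun l _ => ?_
  rw [integral_finsetSum _ fun k _ => integrable_mul_char hu _, Finset.mul_sum]
  refine Finset.sum_congr rfl fun k _ => ?_
  rw [scalarCoeff, mul_inv_cancel_left₀ (two_pi_pow_ne_zero n)]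

/-- The function is paired with the nonnegative kernel `|∑_{k ∈ Q} e^{i⟨k,x⟩}|²`, whose integral is
`(2π)^n |Q|`. -/
theorem sum_sum_scalarCoeff_le {u : Torus n → ℂ} (hu : Integrable u) {C : ℝ}
    (hC : ∀ᵐ x, ‖u x‖ ≤ C) (Q : Finset (Fin n → ℤ)) :
    ‖∑ l ∈ Q, ∑ k ∈ Q, scalarCoeff u (k - l)‖ ≤ C * Q.card := by
  have hcont : Continuous fun x : Torus n => ‖∑ k ∈ Q, char k x‖ ^ 2 :=
    (continuous_finsetSum _ fun k _ => continuous_char k).norm.pow 2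
  have hone : ∫ x : Torus n, ‖∑ k ∈ Q, char k x‖ ^ 2 = (2 * Real.pi) ^ n * Q.card := by
    have h := integral_mul_normSq_sum_char (n := n) (integrable_const (1 : ℂ)) Q
    have h2 : ∀ d : Fin n → ℤ, scalarCoeff (fun _ => (1 : ℂ)) d = if 0 = d then 1 else 0 := by
      intro d
      rw [← scalarCoeff_char]
      congr 1
      funext x
      exact (char_zero x).symm
    simp only [one_mul, h2] at h
    have h3 : ∀ l ∈ Q, ∑ k ∈ Q, (if 0 = k - l then (1 : ℂ) else 0) = 1 := by
      intro l hl
      rw [Finset.sum_eq_single l]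
      · simp
      · intro k _ hk
        rw [if_neg (sub_ne_zero.mpr hk).symm]
      · exact fun h => absurd hl h
    rw [Finset.sum_congr rfl h3, Finset.sum_const, nsmul_eq_mul, mul_one,
      integral_complex_ofReal] at h
    exact_mod_cast h
  have hbd : ‖∫ x, u x * ((‖∑ k ∈ Q, char k x‖ ^ 2 : ℝ) : ℂ)‖ ≤
      ∫ x : Torus n, C * ‖∑ k ∈ Q, char k x‖ ^ 2 := by
    refine norm_integral_le_of_norm_le ?_ ?_
    · exact ((memLp_of_continuous hcont 1).integrable le_rfl).const_mul C
    · filter_upwards [hC] with x hx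
      rw [norm_mul, Complex.norm_real, Real.norm_of_nonneg (by positivity)]
      gcongr
  rw [integral_const_mul, hone, integral_mul_normSq_sum_char hu, norm_mul] at hbd
  have hvol : ‖((2 * Real.pi : ℂ)) ^ n‖ = (2 * Real.pi) ^ n := by
    rw [norm_pow, norm_mul, Complex.norm_real, Real.norm_of_nonneg Real.pi_nonneg]
    simp
  rw [hvol, mul_left_comm] at hbd
  exact le_of_mul_le_mul_left hbd (by positivity)

/-- Every `d` in the cube is a difference `k - l` with `l ∈ L = [0, 2N]^n` and `k = d + l ∈ Q = [0,
4N]^n`. By nonnegativity the double sum over `Q` is at least `|L|` times the cube sum, and `|Q| ≤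
2^n |L|`. -/
theorem sum_cube_le {u : Torus n → ℂ} (hu : Integrable u) {C : ℝ} (hC : ∀ᵐ x, ‖u x‖ ≤ C)
    {c : (Fin n → ℤ) → ℝ} (hc0 : ∀ k, 0 ≤ c k) (hc : ∀ k, scalarCoeff u k = c k) (N : ℕ) :
    ∑ k ∈ cube n N, c k ≤ 2 ^ n * C := by
  have hC0 : 0 ≤ C := by
    obtain ⟨x, hx⟩ := hC.exists
    exact (norm_nonneg _).trans hx
  let Q : Finset (Fin n → ℤ) := Fintype.piFinset fun _ => Finset.Icc (0 : ℤ) (4 * N)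
  let L : Finset (Fin n → ℤ) := Fintype.piFinset fun _ => Finset.Icc (0 : ℤ) (2 * N)
  have hLQ : L ⊆ Q := Fintype.piFinset_subset _ _ fun _ => Finset.Icc_subset_Icc le_rfl (by omega)
  have hQ : Q.card = (4 * N + 1) ^ n := by
    rw [Fintype.card_piFinset, Finset.prod_const, Finset.card_univ, Fintype.card_fin, Int.card_Icc]
    congr 1
  have hL : L.card = (2 * N + 1) ^ n := by
    rw [Fintype.card_piFinset, Finset.prod_const, Finset.card_univ, Fintype.card_fin, Int.card_Icc]
    congr 1
  have h1 : (L.card : ℝ) * ∑ k ∈ cube n N, c k ≤ ∑ l ∈ Q, ∑ k ∈ Q, c (k - l) := by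
    rw [← nsmul_eq_mul, ← Finset.sum_const]
    refine le_trans (Finset.sum_le_sum fun l hl => ?_) (Finset.sum_le_sum_of_subset_of_nonneg hLQ
      fun l _ _ => Finset.sum_nonneg fun k _ => hc0 _)
    have hinj : Function.Injective fun k : Fin n → ℤ => k + l := add_left_injective l
    calc ∑ k ∈ cube n N, c k = ∑ k ∈ (cube n N).map ⟨_, hinj⟩, c (k - l) := by
          rw [Finset.sum_map]
          simp
      _ ≤ _ := by
          refine Finset.sum_le_sum_of_subset_of_nonneg ?_ fun k _ _ => hc0 _
          intro k hk
          obtain ⟨d, hd, rfl⟩ := Finset.mem_map.mp hk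
          simp only [cube, L, Q, Fintype.mem_piFinset, Finset.mem_Ioc, Finset.mem_Icc] at hd hl ⊢
          intro j
          have := hd j
          have := hl j
          simp only [Function.Embedding.coeFn_mk, Pi.add_apply]
          omega
  have h2 := sum_sum_scalarCoeff_le hu hC Q
  simp only [hc] at h2
  have hcast : ∑ l ∈ Q, ∑ k ∈ Q, (c (k - l) : ℂ) = ((∑ l ∈ Q, ∑ k ∈ Q, c (k - l) : ℝ) : ℂ) := by
    push_cast
    rfl
  rw [hcast, Complex.norm_real] at h2
  have h3 : (Q.card : ℝ) ≤ L.card * 2 ^ n := by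
    have : (4 * N + 1) ^ n ≤ (2 * N + 1) ^ n * 2 ^ n := by
      rw [← mul_pow]
      exact Nat.pow_le_pow_left (by omega) n
    rw [hQ, hL]
    exact_mod_cast this
  have hLpos : (0 : ℝ) < L.card := by
    rw [hL]
    positivity
  refine le_of_mul_le_mul_left ?_ hLpos
  calc (L.card : ℝ) * ∑ k ∈ cube n N, c k ≤ C * Q.card :=
        h1.trans ((le_abs_self _).trans h2)
    _ ≤ C * (L.card * 2 ^ n) := by gcongr
    _ = _ := by ring

/-! ### Fourier series supported in the positive orthant -/

open Classical in
/-- The coefficients `|k|^(-σ)` on the frequencies with positive entries, and `0` elsewhere. -/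
noncomputable def orthantCoeff (σ : ℝ) (k : Fin n → ℤ) : ℝ :=
  if ∀ j, 0 < k j then freq k ^ (-σ) else 0

theorem orthantCoeff_nonneg (σ : ℝ) (k : Fin n → ℤ) : 0 ≤ orthantCoeff σ k := by
  have := freq_nonneg k
  unfold orthantCoeff
  split_ifs <;> positivity

theorem orthantCoeff_le (σ : ℝ) (k : Fin n → ℤ) : orthantCoeff σ k ≤ freq k ^ (-σ) := by
  have := freq_nonneg k
  unfold orthantCoeff
  split_ifs
  · rfl
  · positivity

/-- When all `k_j > 0`, the phase of `(i k_j)^{α_j}` is `i^{α_j}`, independent of `k`. This is the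
reason for restricting to the orthant. -/
theorem multiplier_mul_orthantCoeff (α : Fin n → ℕ) (σ : ℝ) (k : Fin n → ℤ) :
    multiplier α k * orthantCoeff σ k =
      Complex.I ^ (∑ j, α j) * ((‖multiplier α k‖ * orthantCoeff σ k : ℝ) : ℂ) := by
  by_cases hk : ∀ j, 0 < k j
  · have : multiplier α k = Complex.I ^ (∑ j, α j) * (‖multiplier α k‖ : ℝ) := by
      rw [norm_multiplier, multiplier, ← Finset.prod_pow_eq_pow_sum, Complex.ofReal_prod,
        ← Finset.prod_mul_distrib]
      refine Finset.prod_congr rfl fun j _ => ?_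
      rw [mul_pow, abs_of_pos (by exact_mod_cast hk j)]
      push_cast
      rfl
    rw [Complex.ofReal_mul, ← mul_assoc, ← this]
  · simp [orthantCoeff, hk]

/-- On the `N^n` points of the cube every `|k_j| ≥ N` and `|k| ≤ 2nN`, so mixed and pure derivatives
of the same order grow alike. The case `p = 1` excludes boundedness, `p = 2` square integrability.
-/
theorem exists_lt_sum_cube (hn : n ≠ 0) {α : Fin n → ℕ} {σ : ℝ} {p : ℕ} (hσ : 0 ≤ σ)
    (h : 0 < n + p * ((∑ j, α j : ℕ) - σ)) (B : ℝ) :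
    ∃ N, B < ∑ k ∈ cube n N, (‖multiplier α k‖ * orthantCoeff σ k) ^ p := by
  have hn0 : (0 : ℝ) < n := by positivity
  have hlow : ∀ N : ℕ, 0 < N → ((2 * n : ℝ) ^ (-σ)) ^ p *
      (N : ℝ) ^ (n + p * ((∑ j, α j : ℕ) - σ)) ≤
      ∑ k ∈ cube n N, (‖multiplier α k‖ * orthantCoeff σ k) ^ p := by
    intro N hN
    have hN0 : (0 : ℝ) < N := by exact_mod_cast hN
    have hcard : (cube n N).card = N ^ n := by
      rw [cube, Fintype.card_piFinset, Finset.prod_const, Finset.card_univ, Fintype.card_fin,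
        Int.card_Ioc]
      congr 1
      omega
    have hterm : ∀ k ∈ cube n N, ((N : ℝ) ^ (∑ j, α j) * (2 * n * N : ℝ) ^ (-σ)) ^ p ≤
        (‖multiplier α k‖ * orthantCoeff σ k) ^ p := by
      intro k hk
      simp only [cube, Fintype.mem_piFinset, Finset.mem_Ioc] at hk
      have hpos : ∀ j, 0 < k j := fun j => by have := (hk j).1; omega
      have habs : ∀ j, |(k j : ℝ)| = k j := fun j => abs_of_pos (by exact_mod_cast hpos j)
      have hlo : ∀ j, (N : ℝ) ≤ |(k j : ℝ)| := fun j => by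
        rw [habs]
        exact_mod_cast (hk j).1.le
      have hhi : ∀ j, |(k j : ℝ)| ≤ 2 * N := fun j => by
        rw [habs]
        exact_mod_cast (hk j).2
      have hfreq : freq k ≤ 2 * n * N := by
        refine (Finset.sum_le_sum fun j _ => hhi j).trans_eq ?_
        simp
        ring
      have hfreq0 : 0 < freq k :=
        zero_lt_one.trans_le (one_le_freq fun h => by
          have := hpos ⟨0, Nat.pos_of_ne_zero hn⟩
          simp [h] at this)
      have horth : orthantCoeff σ k = freq k ^ (-σ) := by
        unfold orthantCoeff
        exact if_pos hpos
      rw [horth, norm_multiplier, ← Finset.prod_pow_eq_pow_sum]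
      refine pow_le_pow_left₀ (by positivity) (mul_le_mul ?_ ?_ (by positivity) (by positivity)) p
      · exact Finset.prod_le_prod (fun j _ => by positivity)
          fun j _ => pow_le_pow_left₀ hN0.le (hlo j) _
      · exact Real.rpow_le_rpow_of_nonpos hfreq0 hfreq (by linarith)
    refine le_trans (le_of_eq ?_) (Finset.card_nsmul_le_sum _ _ _ hterm)
    rw [hcard, nsmul_eq_mul, Real.mul_rpow (by positivity) hN0.le, mul_left_comm, mul_pow _ _ p,
      mul_left_comm, ← Real.rpow_natCast (N : ℝ) (∑ j, α j), ← Real.rpow_add hN0,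
      ← Real.rpow_mul_natCast hN0.le, Nat.cast_pow, ← Real.rpow_natCast (N : ℝ) n,
      ← Real.rpow_add hN0]
    congr 2
    ring
  have hlim : Filter.Tendsto (fun N : ℕ => ((2 * n : ℝ) ^ (-σ)) ^ p *
      (N : ℝ) ^ (n + p * ((∑ j, α j : ℕ) - σ))) Filter.atTop Filter.atTop :=
    ((tendsto_rpow_atTop h).comp tendsto_natCast_atTop_atTop).const_mul_atTop (by positivity)
  obtain ⟨N, hN1, hN2⟩ := ((hlim.eventually_gt_atTop B).and (Filter.eventually_gt_atTop 0)).exists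
  exact ⟨N, hN1.trans_le (hlow N hN2)⟩

theorem not_ae_bounded_of_scalarCoeff (hn : n ≠ 0) {v : Torus n → ℂ} (hv : MemLp v 2)
    {α : Fin n → ℕ} {σ : ℝ} (hσ : 0 ≤ σ)
    (hc : ∀ k, scalarCoeff v k = multiplier α k * orthantCoeff σ k)
    (h : σ < n + (∑ j, α j : ℕ)) (C : ℝ) : ¬ ∀ᵐ x, ‖v x‖ ≤ C := by
  intro hC
  obtain ⟨N, hN⟩ := exists_lt_sum_cube hn (α := α) (p := 1) hσ (by push_cast at h ⊢; linarith)
    (2 ^ n * C)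
  simp only [pow_one] at hN
  -- The factor `(-i)^{|α|}` cancels the common phase and makes all coefficients nonnegative.
  refine absurd (sum_cube_le (u := fun x => (-Complex.I) ^ (∑ j, α j) * v x) (C := C)
    ((hv.integrable one_le_two).const_mul _) ?_
    (fun k => mul_nonneg (norm_nonneg _) (orthantCoeff_nonneg _ _)) (fun k => ?_) N) hN.not_ge
  · filter_upwards [hC] with x hx
    simpa using hx
  · rw [scalarCoeff_const_mul, hc, multiplier_mul_orthantCoeff, ← mul_assoc, ← mul_pow]
    simp

theorem false_of_scalarCoeff (hn : n ≠ 0) {v : Torus n → ℂ} (hv : MemLp v 2)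
    {α : Fin n → ℕ} {σ : ℝ} (hσ : 0 ≤ σ)
    (hc : ∀ k, scalarCoeff v k = multiplier α k * orthantCoeff σ k)
    (h : 2 * σ < n + 2 * (∑ j, α j : ℕ)) : False := by
  have hs := summable_norm_scalarCoeff_sq hv
  obtain ⟨N, hN⟩ := exists_lt_sum_cube hn (α := α) (p := 2) hσ (by push_cast at h ⊢; linarith)
    (∑' k, ‖scalarCoeff v k‖ ^ 2)
  refine absurd (hs.sum_le_tsum (cube n N) fun k _ => by positivity) ?_
  rw [not_le]
  convert! hN using 3 with k
  rw [hc, norm_mul, Complex.norm_real, Real.norm_of_nonneg (orthantCoeff_nonneg _ _)]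

/-! ### The extremal map -/

theorem summable_freq_rpow {q : ℝ} (hq : (n : ℝ) < q) :
    Summable fun k : Fin n → ℤ => freq k ^ (-q) := by
  have hfreq := freq_nonneg (n := n)
  refine summable_of_tsum_ofReal_lt_top (fun k => by have := hfreq k; positivity) ?_
  -- `le_rfl` fixes the base `b = 2`; summability does not depend on it.
  refine (tsum_le_tsum_shell le_rfl _).trans_lt
    (ENNReal.add_lt_top.mpr ⟨ENNReal.ofReal_lt_top, ?_⟩)
  have hq0 : 0 ≤ q := le_trans (by positivity) hq.le
  refine (ENNReal.tsum_le_tsum fun ν => tsum_shell_rpow_le le_rfl ν hq0).trans_lt ?_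
  refine Summable.tsum_ofReal_lt_top (Summable.mul_left _ ?_)
  refine summable_geometric_of_lt_one (by positivity) ?_
  exact Real.rpow_lt_one_of_one_lt_of_neg (by norm_num) (by linarith)

theorem scalarCoeff_add_const_mul {u v : Torus n → ℂ} (hu : Integrable u) (hv : Integrable v)
    (c : ℂ) (k : Fin n → ℤ) :
    scalarCoeff (fun x => u x + c * v x) k = scalarCoeff u k + c * scalarCoeff v k := by
  simp only [scalarCoeff, add_mul, mul_assoc]
  rw [integral_add (integrable_mul_char hu _) ((integrable_mul_char hv _).const_mul c),
    integral_const_mul]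
  ring

theorem scalarCoeff_conj (u : Torus n → ℂ) (k : Fin n → ℤ) :
    scalarCoeff (fun x => conj (u x)) k = conj (scalarCoeff u (-k)) := by
  rw [scalarCoeff, scalarCoeff, map_mul, ← integral_conj]
  simp only [map_mul, map_inv₀, map_pow, Complex.conj_ofReal, map_ofNat, neg_neg, char_neg]

theorem scalarCoeff_re_mul {u : Torus n → ℂ} (hu : Integrable u) (c : ℂ) (k : Fin n → ℤ) :
    scalarCoeff (fun x => ((c * u x).re : ℂ)) k =
      (c * scalarCoeff u k + conj c * conj (scalarCoeff u (-k))) / 2 := by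
  have h1 : (fun x => ((c * u x).re : ℂ)) =
      fun x => (c / 2 * u x) + conj c / 2 * conj (u x) := by
    funext x
    rw [Complex.re_eq_add_conj, map_mul]
    ring
  have hconj : Integrable fun x => conj (u x) :=
    (Complex.conjCLE : ℂ →L[ℝ] ℂ).integrable_comp hu
  rw [h1, scalarCoeff_add_const_mul (hu.const_mul _) hconj, scalarCoeff_conj,
    scalarCoeff_const_mul]
  ring

/-- A real component has conjugate-symmetric coefficients and cannot live on one orthant. Two
components, `f_i = Re F` and `f_j = Im F`, combine to `f_i + i f_j = F`, which can; this needs two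
distinct indices. -/
theorem exists_mem_poschelSpace_scalarCoeff {τ ε : ℝ} (hτ : 0 ≤ τ) (hε : 0 < ε)
    {b : ℕ} (hb : 2 ≤ b) (i j : Fin n) (hij : i ≠ j) :
    ∃ f ∈ poschelSpace n τ b, ∀ k,
      scalarCoeff (fun x => (f x i : ℂ)) k + Complex.I * scalarCoeff (fun x => (f x j : ℂ)) k =
        orthantCoeff (τ + 1 + n / 2 + ε) k := by
  set σ := τ + 1 + n / 2 + ε with hσ
  have hsq : ∀ k : Fin n → ℤ, (freq k ^ (-σ)) ^ 2 = freq k ^ (-(2 * τ + 2 + n + 2 * ε)) := by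
    intro k
    rw [← Real.rpow_mul_natCast (freq_nonneg k)]
    congr 1
    push_cast
    rw [hσ]
    ring
  have hsum : Summable fun k : Fin n → ℤ => ‖(orthantCoeff σ k : ℂ)‖ ^ 2 := by
    refine Summable.of_nonneg_of_le (fun k => by positivity) (fun k => ?_)
      (summable_freq_rpow (n := n) (q := 2 * τ + 2 + n + 2 * ε) (by linarith))
    rw [← hsq, Complex.norm_real, Real.norm_of_nonneg (orthantCoeff_nonneg _ _)]
    exact pow_le_pow_left₀ (orthantCoeff_nonneg _ _) (orthantCoeff_le σ k) 2
  obtain ⟨F, hF, hFc⟩ := exists_scalarCoeff_eq hsum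
  have hFi := hF.integrable one_le_two
  -- Component `l` will be `Re (w_l F)`, and `Re (-iF) = Im F`; the remaining components vanish.
  let w : Fin n → ℂ := fun l => if l = i then 1 else if l = j then -Complex.I else 0
  have hw : ∀ l, ‖w l‖ ≤ 1 := by
    intro l
    simp only [w]
    split_ifs <;> simp
  have hwi : w i = 1 := if_pos rfl
  have hwj : w j = -Complex.I := by simp [w, hij.symm]
  have hcoef : ∀ l k, scalarCoeff (fun x => ((w l * F x).re : ℂ)) k =
      (w l * orthantCoeff σ k + conj (w l) * orthantCoeff σ (-k)) / 2 := by
    intro l k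
    rw [scalarCoeff_re_mul hFi, hFc, hFc, Complex.conj_ofReal]
  have hcoef_le : ∀ l k, ‖scalarCoeff (fun x => ((w l * F x).re : ℂ)) k‖ ≤ freq k ^ (-σ) := by
    intro l k
    have h1 : ∀ k : Fin n → ℤ, ‖(orthantCoeff σ k : ℂ)‖ ≤ freq k ^ (-σ) := fun k => by
      rw [Complex.norm_real, Real.norm_of_nonneg (orthantCoeff_nonneg _ _)]
      exact orthantCoeff_le σ k
    have h2 := h1 (-k)
    rw [freq_neg] at h2
    have h3 : ‖w l * orthantCoeff σ k‖ ≤ freq k ^ (-σ) := by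
      rw [norm_mul]
      exact (mul_le_of_le_one_left (norm_nonneg _) (hw l)).trans (h1 k)
    have h4 : ‖conj (w l) * orthantCoeff σ (-k)‖ ≤ freq k ^ (-σ) := by
      rw [norm_mul, RCLike.norm_conj]
      exact (mul_le_of_le_one_left (norm_nonneg _) (hw l)).trans h2
    rw [hcoef, norm_div, Complex.norm_ofNat]
    linarith [norm_add_le (w l * orthantCoeff σ k) (conj (w l) * orthantCoeff σ (-k))]
  refine ⟨fun x => WithLp.toLp 2 fun l => (w l * F x).re, ⟨?_, ?_⟩, fun k => ?_⟩
  · exact MemLp.of_eval_piLp fun l => (hF.const_mul (w l)).re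
  · refine poschelNorm_lt_top_of_le (C := n) hb hε (by positivity) fun k _ => ?_
    rw [EuclideanSpace.norm_sq_eq]
    refine (Finset.sum_le_card_nsmul _ _ (freq k ^ (-(2 * τ + 2 + n + 2 * ε)))
      fun l _ => ?_).trans_eq (by simp)
    rw [← hsq]
    exact pow_le_pow_left₀ (norm_nonneg _) (hcoef_le l k) 2
  · change scalarCoeff (fun x => ((w i * F x).re : ℂ)) k +
      Complex.I * scalarCoeff (fun x => ((w j * F x).re : ℂ)) k = _
    rw [hcoef, hcoef, hwi, hwj]
    simp only [map_one, map_neg, Complex.conj_I]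
    linear_combination (-(orthantCoeff σ k : ℂ) / 2 + (orthantCoeff σ (-k) : ℂ) / 2) * Complex.I_sq

/-! ### Fourier coefficients of weak derivatives -/

theorem IsWeakDeriv.scalarCoeff {α : Fin n → ℕ} {f g : Torus n → EuclideanSpace ℝ (Fin n)}
    (hf : MemLp f 2) (h : IsWeakDeriv α f g) (i : Fin n) (k : Fin n → ℤ) :
    Torus.scalarCoeff (fun x => (g x i : ℂ)) k =
      multiplier α k * Torus.scalarCoeff (fun x => (f x i : ℂ)) k := by
  have hre : ∀ {u : Torus n → EuclideanSpace ℝ (Fin n)}, MemLp u 2 → ∀ c : ℂ,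
      ∫ x, (c * char (-k) x).re * u x i = (c * ∫ x, (u x i : ℂ) * char (-k) x).re := by
    intro u hu c
    have hint := (integrable_mul_char ((memLp_ofReal_apply hu i).integrable one_le_two)
      (-k)).const_mul c
    rw [← integral_const_mul]
    have := integral_re hint
    simp only [RCLike.re_to_complex] at this
    rw [← this]
    congr 1
    funext x
    rw [mul_left_comm, Complex.re_ofReal_mul, mul_comm]
  have key : ∀ c : ℂ, (c * (multiplier α k * ∫ x, (f x i : ℂ) * char (-k) x)).re =
      (c * ∫ x, (g x i : ℂ) * char (-k) x).re := by
    intro c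
    have h1 := h.2 _ (isClassC_re_mul_char _ c (-k))
    have h2 := congr_arg (fun v : EuclideanSpace ℝ (Fin n) => v i) h1
    simp only [PiLp.smul_apply] at h2
    rw [eval_integral_piLp fun i => integrable_smul_apply
        (isClassC_re_mul_char ⊤ c (-k)).continuous h.1 i,
      eval_integral_piLp fun i => integrable_smul_apply
        (IsClassC.multiDeriv (isClassC_re_mul_char ⊤ c (-k)) α).1.continuous hf i] at h2
    simp only [PiLp.smul_apply, smul_eq_mul, multiDeriv_re_mul_char] at h2
    rw [hre hf, hre h.1, multiplier_neg] at h2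
    have h3 : ((-1 : ℂ) ^ (∑ j, α j)) = (((-1 : ℝ) ^ (∑ j, α j) : ℝ) : ℂ) := by push_cast; rfl
    rw [h3, mul_assoc, mul_assoc, Complex.re_ofReal_mul] at h2
    have h4 := mul_left_cancel₀ (pow_ne_zero _ (by norm_num)) h2
    rw [← h4]
    congr 1
    ring
  -- `c = 1` compares real parts and `c = -i` imaginary parts.
  have hre1 := key 1
  have him := key (-Complex.I)
  simp only [one_mul] at hre1
  simp only [neg_mul, Complex.neg_re, Complex.I_mul_re, neg_neg] at him
  have := Complex.ext hre1 him
  rw [Torus.scalarCoeff, Torus.scalarCoeff, ← this]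
  ring

/-! ### Obstructions to regularity for maps with orthant coefficients -/

theorem multiplier_single (i : Fin n) (m : ℕ) (k : Fin n → ℤ) :
    multiplier (Pi.single i m) k = (Complex.I * k i) ^ m := by
  rw [multiplier, Finset.prod_eq_single i]
  · simp
  · intro j _ hj
    simp [hj]
  · simp

theorem memLp_add_I_mul {u v : Torus n → ℂ} (hu : MemLp u 2) (hv : MemLp v 2) :
    MemLp (fun x => u x + Complex.I * v x) 2 :=
  hu.add (hv.const_mul Complex.I)

theorem scalarCoeff_add_I_mul_of_multiplier {u v p q : Torus n → ℂ} {α : Fin n → ℕ} {σ : ℝ}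
    (hu : MemLp u 2) (hv : MemLp v 2)
    (hup : ∀ k, scalarCoeff u k = multiplier α k * scalarCoeff p k)
    (hvq : ∀ k, scalarCoeff v k = multiplier α k * scalarCoeff q k)
    (h : ∀ k, scalarCoeff p k + Complex.I * scalarCoeff q k = orthantCoeff σ k)
    (k : Fin n → ℤ) :
    scalarCoeff (fun x => u x + Complex.I * v x) k = multiplier α k * orthantCoeff σ k := by
  rw [scalarCoeff_add_const_mul (hu.integrable one_le_two) (hv.integrable one_le_two), hup, hvq,
    ← h]
  ring

theorem not_isClassC_of_scalarCoeff {f : Torus n → EuclideanSpace ℝ (Fin n)} {i j : Fin n}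
    {σ : ℝ} (hσ : 0 ≤ σ)
    (h : ∀ k, scalarCoeff (fun x => (f x i : ℂ)) k +
      Complex.I * scalarCoeff (fun x => (f x j : ℂ)) k = orthantCoeff σ k)
    {m : ℕ} (hm : σ < n + m) :
    ¬ ∃ g : Torus n → EuclideanSpace ℝ (Fin n), IsClassC (m : ℕ∞) g ∧ f =ᵐ[volume] g := by
  rintro ⟨g, hg, hfg⟩
  have hn : n ≠ 0 := fun h => by subst h; exact i.elim0
  -- One pure derivative suffices: for a `C^m` representative `∂_i^m` would be continuous, hence
  -- bounded on the compact torus.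
  let α : Fin n → ℕ := Pi.single i m
  have hα : ∑ j, α j = m := by simp [α]
  let ψ : Fin n → Torus n → ℝ := fun l => (partialDeriv i)^[m] fun x => g x l
  have hψ : ∀ l, Continuous (ψ l) ∧ ∀ k, scalarCoeff (fun x => (ψ l x : ℂ)) k =
      multiplier α k * scalarCoeff (fun x => (f x l : ℂ)) k := by
    intro l
    have hgl : IsClassC (0 + (m : ℕ∞)) (fun x => g x l : Torus n → ℝ) := by
      rw [zero_add]
      exact contDiff_euclidean.mp hg l
    obtain ⟨h1, h2⟩ := hgl.iterate_partialDeriv i m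
    refine ⟨h1.continuous, fun k => ?_⟩
    rw [multiplier_single, h2]
    have hae : (fun x => (g x l : ℂ) * char (-k) x) =ᵐ[volume]
        fun x => (f x l : ℂ) * char (-k) x := by
      filter_upwards [hfg] with x hx
      rw [hx]
    simp only [scalarCoeff, integral_congr_ae hae]
  have hcont : ∀ l, Continuous fun x => (ψ l x : ℂ) := fun l =>
    Complex.continuous_ofReal.comp (hψ l).1
  have hmem := fun l => memLp_of_continuous (hcont l) 2
  obtain ⟨C, hC⟩ := exists_norm_le_of_continuous
    ((hcont i).add (continuous_const.mul (hcont j)) :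
      Continuous fun x => (ψ i x : ℂ) + Complex.I * (ψ j x : ℂ))
  refine not_ae_bounded_of_scalarCoeff hn (memLp_add_I_mul (hmem i) (hmem j)) (α := α) hσ
    (scalarCoeff_add_I_mul_of_multiplier (hmem i) (hmem j) (hψ i).2 (hψ j).2 h) ?_ C
    (.of_forall hC)
  rwa [hα]

theorem IsWeakDeriv.essUnbounded_of_scalarCoeff {f g : Torus n → EuclideanSpace ℝ (Fin n)}
    {α : Fin n → ℕ} {i j : Fin n} {σ : ℝ} (hσ : 0 ≤ σ) (hf : MemLp f 2)
    (hfg : IsWeakDeriv α f g)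
    (h : ∀ k, Torus.scalarCoeff (fun x => (f x i : ℂ)) k +
      Complex.I * Torus.scalarCoeff (fun x => (f x j : ℂ)) k = orthantCoeff σ k)
    (hα : σ < n + (∑ j, α j : ℕ)) : EssUnbounded g := by
  intro C hC
  have hn : n ≠ 0 := fun h => by subst h; exact i.elim0
  have hmem := memLp_ofReal_apply hfg.1
  refine not_ae_bounded_of_scalarCoeff hn (memLp_add_I_mul (hmem i) (hmem j)) hσ
    (scalarCoeff_add_I_mul_of_multiplier (hmem i) (hmem j) (hfg.scalarCoeff hf i)
      (hfg.scalarCoeff hf j) h) hα (C + C) ?_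
  filter_upwards [hC] with x hx
  refine (norm_add_le _ _).trans (add_le_add ?_ ?_)
  · rw [Complex.norm_real]
    exact (PiLp.norm_apply_le (g x) i).trans hx
  · rw [norm_mul, Complex.norm_I, one_mul, Complex.norm_real]
    exact (PiLp.norm_apply_le (g x) j).trans hx

theorem not_isWeakDeriv_of_scalarCoeff {f g : Torus n → EuclideanSpace ℝ (Fin n)}
    {α : Fin n → ℕ} {i j : Fin n} {σ : ℝ} (hσ : 0 ≤ σ) (hf : MemLp f 2)
    (h : ∀ k, scalarCoeff (fun x => (f x i : ℂ)) k +
      Complex.I * scalarCoeff (fun x => (f x j : ℂ)) k = orthantCoeff σ k)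
    (hα : 2 * σ < n + 2 * (∑ j, α j : ℕ)) : ¬ IsWeakDeriv α f g := by
  intro hfg
  have hn : n ≠ 0 := fun h => by subst h; exact i.elim0
  have hmem := memLp_ofReal_apply hfg.1
  exact false_of_scalarCoeff hn (memLp_add_I_mul (hmem i) (hmem j)) hσ
    (scalarCoeff_add_I_mul_of_multiplier (hmem i) (hmem j) (hfg.scalarCoeff hf i)
      (hfg.scalarCoeff hf j) h) hα

end Torus

theorem theorem1p4 (n : ℕ) (hn : 2 ≤ n) (τ : ℝ) (hτ : (n : ℝ) - 1 ≤ τ) (b : ℕ) (hb : 2 ≤ b) :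
    -- every element has classical derivatives up to order `[τ - n/2] + 1`
    (∀ f ∈ Torus.poschelSpace n τ b, ∃ g : Torus n → EuclideanSpace ℝ (Fin n),
      Torus.IsClassC ((⌊τ - n / 2⌋₊ + 1 : ℕ) : ℕ∞) g ∧ f =ᵐ[volume] g) ∧
    -- every element has weak derivatives up to order `[τ] + 1`
    (∀ f ∈ Torus.poschelSpace n τ b, ∀ α : Fin n → ℕ, ∑ j, α j ≤ ⌊τ⌋₊ + 1 →
      ∃ g, Torus.IsWeakDeriv α f g) ∧
    -- some element has unbounded weak derivatives of all orders from `[τ - n/2] + 2` to `[τ] + 1`,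
    -- and it is not of class `C^([τ - n/2] + 2)`
    (∃ f ∈ Torus.poschelSpace n τ b,
      (∀ α : Fin n → ℕ, ⌊τ - n / 2⌋₊ + 2 ≤ ∑ j, α j → ∑ j, α j ≤ ⌊τ⌋₊ + 1 →
        ∃ g, Torus.IsWeakDeriv α f g ∧ Torus.EssUnbounded g) ∧
      ¬ ∃ g : Torus n → EuclideanSpace ℝ (Fin n),
        Torus.IsClassC ((⌊τ - n / 2⌋₊ + 2 : ℕ) : ℕ∞) g ∧ f =ᵐ[volume] g) ∧
    -- some element has no weak derivatives of order `[τ] + 2`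
    (∃ f ∈ Torus.poschelSpace n τ b,
      ∀ α : Fin n → ℕ, ∑ j, α j = ⌊τ⌋₊ + 2 → ¬ ∃ g, Torus.IsWeakDeriv α f g) := by
  have hn' : (2 : ℝ) ≤ n := by exact_mod_cast hn
  have hτ0 : 0 ≤ τ := by linarith
  -- From `τ ≥ n - 1` and `n ≥ 2`; thus the natural-number floor is the true integer part.
  have hτn : 0 ≤ τ - n / 2 := by linarith
  have hfl1 := Nat.lt_floor_add_one (τ - n / 2)
  have hfl2 := Nat.lt_floor_add_one τ
  refine ⟨fun f hf => ?_, fun f hf α hα =>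
    Torus.exists_isWeakDeriv_of_mem_poschelSpace hτ0 hb hf hα, ?_⟩
  · refine Torus.exists_isClassC_of_mem_poschelSpace hb hf ?_
    push_cast
    linarith [Nat.floor_le hτn]
  · obtain ⟨ε, hε, hε'⟩ := exists_between (lt_min (sub_pos.mpr hfl1) (sub_pos.mpr hfl2))
    obtain ⟨hε1, hε2⟩ := lt_min_iff.mp hε'
    have hσ : 0 ≤ τ + 1 + n / 2 + ε := by linarith
    obtain ⟨f, hf, hfc⟩ := Torus.exists_mem_poschelSpace_scalarCoeff (n := n) hτ0 hε hb
      ⟨0, by omega⟩ ⟨1, by omega⟩ (by simp)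
    refine ⟨⟨f, hf, fun α hα1 hα2 => ?_, ?_⟩, f, hf, fun α hα => ?_⟩
    · obtain ⟨g, hg⟩ := Torus.exists_isWeakDeriv_of_mem_poschelSpace hτ0 hb hf hα2
      refine ⟨g, hg, hg.essUnbounded_of_scalarCoeff hσ hf.1 hfc ?_⟩
      have h1 : ((⌊τ - n / 2⌋₊ + 2 : ℕ) : ℝ) ≤ (∑ j, α j : ℕ) := Nat.cast_le.mpr hα1
      push_cast at h1 ⊢
      linarith
    · refine Torus.not_isClassC_of_scalarCoeff hσ hfc ?_
      push_cast
      linarith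
    · rintro ⟨g, hg⟩
      refine Torus.not_isWeakDeriv_of_scalarCoeff hσ hf.1 hfc ?_ hg
      rw [hα]
      push_cast
      linarith
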